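/- **Setting (operational call-by-push-value, CBPV).** Value types $A$ and computation types $\underline B$ are the closed types generated by $$A ::= X \mid \mu X.A \mid U\underline B \mid 0 \mid A_1+A_2 \mid 1 \mid A_1\times A_2,\qquad \underline B ::= \underline Y \mid \nu\underline Y.\underline B \mid \underline F A \mid \top \mid \underline B_1\,\&\,\underline B_2 \mid A\to\underline B .$$ Values, computations and stacks are $$V ::= x \mid \mathsf{roll}\,V \mid \mathsf{inl}\,V \mid \mathsf{inr}\,V \mid () \mid (V_1,V_2) \mid \mathsf{thunk}\,M,$$ $$\begin{aligned}M ::={}& \mho \mid \mathsf{let}\ x=V;M \mid \mathsf{abort}\,V \mid \mathsf{case}\,V\{x_1.M_1\mid x_2.M_2\} \mid \mathsf{split}\,V\,\mathsf{to}\,().M \mid \mathsf{split}\,V\,\mathsf{to}\,(x,y).M \mid \mathsf{split}\,V\,\mathsf{to}\,\mathsf{roll}\,x.M \\ &\mid \mathsf{force}\,V \mid \mathsf{ret}\,V \mid \mathsf{bind}\,x\leftarrow M;N \mid \lambda x{:}A.M \mid M\,V \mid \{\} \mid (M_1,M_2) \mid \pi M \mid \pi' M \mid \mathsf{roll}\,M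 \mid \mathsf{unroll}\,M,\end{aligned}$$ $$S ::= \bullet \mid \mathsf{bind}\,x\leftarrow S;M \mid S\,V \mid \pi S \mid \pi' S \mid \mathsf{unroll}\,S,$$ with the usual typing judgements $\Gamma\vdash V:A$, $\Gamma\mid\cdot\vdash M:\underline B$, $\Gamma\mid\bullet:\underline B\vdash S:\underline B'$, written uniformly $\Gamma\mid\Delta\vdash E:T$; here $\mathsf{roll}$, $\mathsf{split}\ldots\mathsf{roll}$ and $\mathsf{unroll}$ mediate between $\mu X.A$ and $A[\mu X.A/X]$, resp. $\nu\underline Y.\underline B$ and $\underline B[\nu\underline Y.\underline B/\underline Y]$, and $\mho$ is a run-time error of every computation type. Terms are taken fully type-annotated and up to renaming of bound variables. *Inequational theory.* $\Gamma\mid\Delta\vdash E\sqsubseteq E':T$ is the least family of relations between values, between computations and between stacks of the same type that is reflexive and transitive, is closed under all term constructors (congruence), under substitution of related values for a variable, under plugging related computations into related stacks and under composition of related stacks, contains $\mho\sqsubseteq M$ for every $M$, and contains both directions of the following axioms: the $\beta$ laws of $\mathsf{let}$, $+$, $1$, $\times$, $\mu$, $U$, $\underline F$, $\to$, $\&$,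 $\nu$; the $\eta$ laws - for $\Gamma,x{:}A\vdash M:\underline B$ with $A$ one of $0,\ A_1+A_2,\ 1,\ A_1\times A_2,\ \mu X.A'$: respectively $M\sqsupseteq\sqsubseteq\mathsf{abort}\,x$, $\ \mathsf{case}\,x\{x_1.M[\mathsf{inl}\,x_1/x]\mid x_2.M[\mathsf{inr}\,x_2/x]\}$, $\ M[()/x]$, $\ \mathsf{split}\,x\,\mathsf{to}\,(x_1,x_2).M[(x_1,x_2)/x]$, $\ \mathsf{split}\,x\,\mathsf{to}\,\mathsf{roll}\,y.M[\mathsf{roll}\,y/x]$; - $V\sqsupseteq\sqsubseteq\mathsf{thunk}\,\mathsf{force}\,V$ at $U\underline B$; $\ S\sqsupseteq\sqsubseteq\mathsf{bind}\,x\leftarrow\bullet;S[\mathsf{ret}\,x]$ for $\Gamma\mid\bullet:\underline FA\vdash S:\underline B$; $\ M\sqsupseteq\sqsubseteq\lambda x{:}A.M\,x$ at $A\to\underline B$; $\ M\sqsupseteq\sqsubseteq(\pi M,\pi'M)$ at $\underline B_1\&\underline B_2$; $\ M\sqsupseteq\sqsubseteq\{\}$ at $\top$; $\ M\sqsupseteq\sqsubseteq\mathsf{roll}\,\mathsf{unroll}\,M$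 at $\nu\underline Y.\underline B$; and error strictness $S[\mho]\sqsupseteq\sqsubseteq\mho$. Write $E\sqsupseteq\sqsubseteq E'$ for $E\sqsubseteq E'$ and $E'\sqsubseteq E$. *Operational semantics.* Programs are computations $\cdot\vdash M:\underline F(1+1)$. They step by $S[M]\mapsto S[M']$ where $M\mapsto M'$ is a $\beta$ contraction, and by $S[\mho]\mapsto\mho$ for $S\neq\bullet$. Put $\mathsf{true}=\mathsf{inl}\,()$, $\mathsf{false}=\mathsf{inr}\,()$. The result $\mathrm{result}(M)$ is $\Omega$ if every program reachable from $M$ can step, and otherwise the one of $\mho$, $\mathsf{ret}\,\mathsf{true}$, $\mathsf{ret}\,\mathsf{false}$ that $M$ reduces to. On results, $R\sqsubseteq R'$ means $R=\mho$ or $R=R'$. *Contexts.* A context $C:(\Gamma\mid\Delta\vdash T)\Rightarrow(\cdot\vdash\underline F(1+1))$ is a closed program of type $\underline F(1+1)$ with a single typed hole, possibly under binders, for a value, computation or stack of type $\Gamma\mid\Delta\vdash T$; a stack put into such a hole may be extended by further stack frames and is run on a computation. $C[E]$ is the result of filling the hole with $E$. **Theorem (Contextual Approximation/Equivalence Model of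 CBPV).** Let $\Gamma\mid\Delta\vdash E:T$ and $\Gamma\mid\Delta\vdash E':T$ be values, computations or stacks. 1. If $\Gamma\mid\Delta\vdash E\sqsubseteq E':T$ is derivable, then $E$ contextually error-approximates $E'$: for every context $C:(\Gamma\mid\Delta\vdash T)\Rightarrow(\cdot\vdash\underline F(1+1))$, $\ \mathrm{result}(C[E])\sqsubseteq\mathrm{result}(C[E'])$. 2. If $\Gamma\mid\Delta\vdash E\sqsupseteq\sqsubseteq E':T$ is derivable, then $E$ and $E'$ are contextually equivalent: for every such $C$, $\ \mathrm{result}(C[E])=\mathrm{result}(C[E'])$. -/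

import Mathlib

/-! Operational call-by-push-value with recursive value types, corecursive computation types and
a run-time error: syntax, inequational theory, operational semantics, contextual lifting.

Syntax is intrinsically scoped and typed with de Bruijn indices, so an element of `Tm Γ j` is a
derivable typing judgement, and the implicit typing premises of all rules are automatic. -/

namespace CBPV

/-! ### Variables -/

/-- Typed de Bruijn variables: `Var Γ a` is the type of occurrences of `a` in `Γ`.
The head of the list is the most recently bound variable. -/
inductive Var {α : Type} : List α → α → Type
  | zero {Γ : List α} {a : α} : Var (a :: Γ) a
  | succ {Γ : List α} {a b : α} : Var Γ a → Var (b :: Γ) a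

/-- Type-preserving maps of variables. -/
abbrev Ren {α : Type} (Γ Δ : List α) : Type := ∀ a : α, Var Γ a → Var Δ a

def Ren.lift {α : Type} {Γ Δ : List α} {b : α} (ρ : Ren Γ Δ) : Ren (b :: Γ) (b :: Δ)
  | _, .zero => .zero
  | _, .succ x => .succ (ρ _ x)

/-! ### Types -/

inductive Kind : Type
  | val
  | comp

/-- `Ty Θ .val` are the value types and `Ty Θ .comp` the computation types with free
type variables (of either kind) in `Θ`. -/
inductive Ty : List Kind → Kind → Type
  | var {Θ : List Kind} {k : Kind} : Var Θ k → Ty Θ k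
  | mu {Θ : List Kind} : Ty (.val :: Θ) .val → Ty Θ .val
  | U {Θ : List Kind} : Ty Θ .comp → Ty Θ .val
  | zero {Θ : List Kind} : Ty Θ .val
  | sum {Θ : List Kind} : Ty Θ .val → Ty Θ .val → Ty Θ .val
  | one {Θ : List Kind} : Ty Θ .val
  | prod {Θ : List Kind} : Ty Θ .val → Ty Θ .val → Ty Θ .val
  | nu {Θ : List Kind} : Ty (.comp :: Θ) .comp → Ty Θ .comp
  | F {Θ : List Kind} : Ty Θ .val → Ty Θ .comp
  | top {Θ : List Kind} : Ty Θ .comp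
  | amp {Θ : List Kind} : Ty Θ .comp → Ty Θ .comp → Ty Θ .comp
  | arr {Θ : List Kind} : Ty Θ .val → Ty Θ .comp → Ty Θ .comp

def Ty.rename {Θ Ξ : List Kind} {k : Kind} : Ty Θ k → Ren Θ Ξ → Ty Ξ k
  | .var x, ρ => .var (ρ _ x)
  | .mu A, ρ => .mu (A.rename ρ.lift)
  | .U B, ρ => .U (B.rename ρ)
  | .zero, _ => .zero
  | .sum A A', ρ => .sum (A.rename ρ) (A'.rename ρ)
  | .one, _ => .one
  | .prod A A', ρ => .prod (A.rename ρ) (A'.rename ρ)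
  | .nu B, ρ => .nu (B.rename ρ.lift)
  | .F A, ρ => .F (A.rename ρ)
  | .top, _ => .top
  | .amp B B', ρ => .amp (B.rename ρ) (B'.rename ρ)
  | .arr A B, ρ => .arr (A.rename ρ) (B.rename ρ)

/-- Simultaneous substitutions of types for type variables. -/
abbrev TySub (Θ Ξ : List Kind) : Type := ∀ k : Kind, Var Θ k → Ty Ξ k

def TySub.lift {Θ Ξ : List Kind} {l : Kind} (σ : TySub Θ Ξ) : TySub (l :: Θ) (l :: Ξ)
  | _, .zero => .var .zero
  | _, .succ x => (σ _ x).rename (fun _ y => .succ y)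

def Ty.subst {Θ Ξ : List Kind} {k : Kind} : Ty Θ k → TySub Θ Ξ → Ty Ξ k
  | .var x, σ => σ _ x
  | .mu A, σ => .mu (A.subst σ.lift)
  | .U B, σ => .U (B.subst σ)
  | .zero, _ => .zero
  | .sum A A', σ => .sum (A.subst σ) (A'.subst σ)
  | .one, _ => .one
  | .prod A A', σ => .prod (A.subst σ) (A'.subst σ)
  | .nu B, σ => .nu (B.subst σ.lift)
  | .F A, σ => .F (A.subst σ)
  | .top, _ => .top
  | .amp B B', σ => .amp (B.subst σ) (B'.subst σ)
  | .arr A B, σ => .arr (A.subst σ) (B.subst σ)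

def TySub.single {Θ : List Kind} {l : Kind} (T : Ty Θ l) : TySub (l :: Θ) Θ
  | _, .zero => T
  | _, .succ x => .var x

/-- Closed value types. -/
abbrev VTy : Type := Ty [] .val

/-- Closed computation types. -/
abbrev CTy : Type := Ty [] .comp

/-- `A[μX.A/X]`. -/
abbrev unfoldMu (A : Ty [.val] .val) : VTy := A.subst (TySub.single (.mu A))

/-- `B[νY.B/Y]`. -/
abbrev unfoldNu (B : Ty [.comp] .comp) : CTy := B.subst (TySub.single (.nu B))

/-- `2 = 1 + 1`. -/
abbrev bool : VTy := .sum .one .one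

/-! ### Terms -/

abbrev Ctx : Type := List VTy

/-- The right-hand sides of typing judgements, together with the stoup:
`val A` is `Γ ⊢ V : A`, `comp B` is `Γ | · ⊢ M : B`, `stk B B'` is `Γ | • : B ⊢ S : B'`. -/
inductive Judg : Type
  | val : VTy → Judg
  | comp : CTy → Judg
  | stk : CTy → CTy → Judg

/-- Well-typed values, computations and stacks. In `unroll` and `unrollS`, the type `B[νY.B/Y]` of
the conclusion is given through an equation. -/
inductive Tm : Ctx → Judg → Type
  -- values
  | var {Γ : Ctx} {A : VTy} : Var Γ A → Tm Γ (.val A)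
  | rollMu {Γ : Ctx} {A : Ty [.val] .val} : Tm Γ (.val (unfoldMu A)) → Tm Γ (.val (.mu A))
  | inl {Γ : Ctx} {A A' : VTy} : Tm Γ (.val A) → Tm Γ (.val (.sum A A'))
  | inr {Γ : Ctx} {A A' : VTy} : Tm Γ (.val A') → Tm Γ (.val (.sum A A'))
  | unit {Γ : Ctx} : Tm Γ (.val .one)
  | pair {Γ : Ctx} {A A' : VTy} : Tm Γ (.val A) → Tm Γ (.val A') → Tm Γ (.val (.prod A A'))
  | thunk {Γ : Ctx} {B : CTy} : Tm Γ (.comp B) → Tm Γ (.val (.U B))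
  -- computations
  | err {Γ : Ctx} {B : CTy} : Tm Γ (.comp B)
  | letv {Γ : Ctx} {A : VTy} {B : CTy} :
      Tm Γ (.val A) → Tm (A :: Γ) (.comp B) → Tm Γ (.comp B)
  | abort {Γ : Ctx} {B : CTy} : Tm Γ (.val .zero) → Tm Γ (.comp B)
  | case {Γ : Ctx} {A A' : VTy} {B : CTy} : Tm Γ (.val (.sum A A')) →
      Tm (A :: Γ) (.comp B) → Tm (A' :: Γ) (.comp B) → Tm Γ (.comp B)
  | splitUnit {Γ : Ctx} {B : CTy} : Tm Γ (.val .one) → Tm Γ (.comp B) → Tm Γ (.comp B)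
  | splitPair {Γ : Ctx} {A A' : VTy} {B : CTy} : Tm Γ (.val (.prod A A')) →
      Tm (A' :: A :: Γ) (.comp B) → Tm Γ (.comp B)
  | splitRoll {Γ : Ctx} {A : Ty [.val] .val} {B : CTy} : Tm Γ (.val (.mu A)) →
      Tm (unfoldMu A :: Γ) (.comp B) → Tm Γ (.comp B)
  | force {Γ : Ctx} {B : CTy} : Tm Γ (.val (.U B)) → Tm Γ (.comp B)
  | ret {Γ : Ctx} {A : VTy} : Tm Γ (.val A) → Tm Γ (.comp (.F A))
  | bind {Γ : Ctx} {A : VTy} {B : CTy} :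
      Tm Γ (.comp (.F A)) → Tm (A :: Γ) (.comp B) → Tm Γ (.comp B)
  | lam {Γ : Ctx} {A : VTy} {B : CTy} : Tm (A :: Γ) (.comp B) → Tm Γ (.comp (.arr A B))
  | app {Γ : Ctx} {A : VTy} {B : CTy} :
      Tm Γ (.comp (.arr A B)) → Tm Γ (.val A) → Tm Γ (.comp B)
  | triv {Γ : Ctx} : Tm Γ (.comp .top)
  | cpair {Γ : Ctx} {B B' : CTy} :
      Tm Γ (.comp B) → Tm Γ (.comp B') → Tm Γ (.comp (.amp B B'))
  | fst {Γ : Ctx} {B B' : CTy} : Tm Γ (.comp (.amp B B')) → Tm Γ (.comp B)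
  | snd {Γ : Ctx} {B B' : CTy} : Tm Γ (.comp (.amp B B')) → Tm Γ (.comp B')
  | rollNu {Γ : Ctx} {B : Ty [.comp] .comp} : Tm Γ (.comp (unfoldNu B)) → Tm Γ (.comp (.nu B))
  | unroll {Γ : Ctx} {B : Ty [.comp] .comp} {C : CTy} (h : C = unfoldNu B) :
      Tm Γ (.comp (.nu B)) → Tm Γ (.comp C)
  -- stacks
  | hole {Γ : Ctx} {B : CTy} : Tm Γ (.stk B B)
  | bindS {Γ : Ctx} {A : VTy} {B C : CTy} :
      Tm Γ (.stk C (.F A)) → Tm (A :: Γ) (.comp B) → Tm Γ (.stk C B)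
  | appS {Γ : Ctx} {A : VTy} {B C : CTy} :
      Tm Γ (.stk C (.arr A B)) → Tm Γ (.val A) → Tm Γ (.stk C B)
  | fstS {Γ : Ctx} {B B' C : CTy} : Tm Γ (.stk C (.amp B B')) → Tm Γ (.stk C B)
  | sndS {Γ : Ctx} {B B' C : CTy} : Tm Γ (.stk C (.amp B B')) → Tm Γ (.stk C B')
  | unrollS {Γ : Ctx} {B : Ty [.comp] .comp} {C D : CTy} (h : D = unfoldNu B) :
      Tm Γ (.stk C (.nu B)) → Tm Γ (.stk C D)

abbrev Val (Γ : Ctx) (A : VTy) : Type := Tm Γ (.val A)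
abbrev Comp (Γ : Ctx) (B : CTy) : Type := Tm Γ (.comp B)
abbrev Stack (Γ : Ctx) (B B' : CTy) : Type := Tm Γ (.stk B B')

/-- Whole programs `· ⊢ M : F 2`. -/
abbrev Program : Type := Comp [] (.F bool)

def Tm.rename {Γ Δ : Ctx} {j : Judg} : Tm Γ j → Ren Γ Δ → Tm Δ j
  | .var x, ρ => .var (ρ _ x)
  | .rollMu V, ρ => .rollMu (V.rename ρ)
  | .inl V, ρ => .inl (V.rename ρ)
  | .inr V, ρ => .inr (V.rename ρ)
  | .unit, _ => .unit
  | .pair V W, ρ => .pair (V.rename ρ) (W.rename ρ)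
  | .thunk M, ρ => .thunk (M.rename ρ)
  | .err, _ => .err
  | .letv V M, ρ => .letv (V.rename ρ) (M.rename ρ.lift)
  | .abort V, ρ => .abort (V.rename ρ)
  | .case V M N, ρ => .case (V.rename ρ) (M.rename ρ.lift) (N.rename ρ.lift)
  | .splitUnit V M, ρ => .splitUnit (V.rename ρ) (M.rename ρ)
  | .splitPair V M, ρ => .splitPair (V.rename ρ) (M.rename ρ.lift.lift)
  | .splitRoll V M, ρ => .splitRoll (V.rename ρ) (M.rename ρ.lift)
  | .force V, ρ => .force (V.rename ρ)
  | .ret V, ρ => .ret (V.rename ρ)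
  | .bind M N, ρ => .bind (M.rename ρ) (N.rename ρ.lift)
  | .lam M, ρ => .lam (M.rename ρ.lift)
  | .app M V, ρ => .app (M.rename ρ) (V.rename ρ)
  | .triv, _ => .triv
  | .cpair M N, ρ => .cpair (M.rename ρ) (N.rename ρ)
  | .fst M, ρ => .fst (M.rename ρ)
  | .snd M, ρ => .snd (M.rename ρ)
  | .rollNu M, ρ => .rollNu (M.rename ρ)
  | .unroll h M, ρ => .unroll h (M.rename ρ)
  | .hole, _ => .hole
  | .bindS S N, ρ => .bindS (S.rename ρ) (N.rename ρ.lift)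
  | .appS S V, ρ => .appS (S.rename ρ) (V.rename ρ)
  | .fstS S, ρ => .fstS (S.rename ρ)
  | .sndS S, ρ => .sndS (S.rename ρ)
  | .unrollS h S, ρ => .unrollS h (S.rename ρ)

/-- Weakening by one variable. -/
abbrev Tm.wk {Γ : Ctx} {A : VTy} {j : Judg} (E : Tm Γ j) : Tm (A :: Γ) j :=
  E.rename (fun _ x => .succ x)

/-- Simultaneous substitutions of values for variables. -/
abbrev Sub (Γ Δ : Ctx) : Type := ∀ A : VTy, Var Γ A → Val Δ A

def Sub.lift {Γ Δ : Ctx} {A : VTy} (σ : Sub Γ Δ) : Sub (A :: Γ) (A :: Δ)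
  | _, .zero => .var .zero
  | _, .succ x => (σ _ x).wk

def Tm.subst {Γ Δ : Ctx} {j : Judg} : Tm Γ j → Sub Γ Δ → Tm Δ j
  | .var x, σ => σ _ x
  | .rollMu V, σ => .rollMu (V.subst σ)
  | .inl V, σ => .inl (V.subst σ)
  | .inr V, σ => .inr (V.subst σ)
  | .unit, _ => .unit
  | .pair V W, σ => .pair (V.subst σ) (W.subst σ)
  | .thunk M, σ => .thunk (M.subst σ)
  | .err, _ => .err
  | .letv V M, σ => .letv (V.subst σ) (M.subst σ.lift)
  | .abort V, σ => .abort (V.subst σ)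
  | .case V M N, σ => .case (V.subst σ) (M.subst σ.lift) (N.subst σ.lift)
  | .splitUnit V M, σ => .splitUnit (V.subst σ) (M.subst σ)
  | .splitPair V M, σ => .splitPair (V.subst σ) (M.subst σ.lift.lift)
  | .splitRoll V M, σ => .splitRoll (V.subst σ) (M.subst σ.lift)
  | .force V, σ => .force (V.subst σ)
  | .ret V, σ => .ret (V.subst σ)
  | .bind M N, σ => .bind (M.subst σ) (N.subst σ.lift)
  | .lam M, σ => .lam (M.subst σ.lift)
  | .app M V, σ => .app (M.subst σ) (V.subst σ)
  | .triv, _ => .triv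
  | .cpair M N, σ => .cpair (M.subst σ) (N.subst σ)
  | .fst M, σ => .fst (M.subst σ)
  | .snd M, σ => .snd (M.subst σ)
  | .rollNu M, σ => .rollNu (M.subst σ)
  | .unroll h M, σ => .unroll h (M.subst σ)
  | .hole, _ => .hole
  | .bindS S N, σ => .bindS (S.subst σ) (N.subst σ.lift)
  | .appS S V, σ => .appS (S.subst σ) (V.subst σ)
  | .fstS S, σ => .fstS (S.subst σ)
  | .sndS S, σ => .sndS (S.subst σ)
  | .unrollS h S, σ => .unrollS h (S.subst σ)

/-- Extends a substitution by a value for the most recent variable. -/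
def Sub.cons {Γ Δ : Ctx} {A : VTy} (V : Val Δ A) (σ : Sub Γ Δ) : Sub (A :: Γ) Δ
  | _, .zero => V
  | _, .succ x => σ _ x

/-- `E[V/x]`. -/
abbrev Tm.inst {Γ : Ctx} {A : VTy} {j : Judg} (E : Tm (A :: Γ) j) (V : Val Γ A) : Tm Γ j :=
  E.subst (Sub.cons V (fun _ x => .var x))

/-- `E[V/x, W/y]`, for `E` in context `Γ, x, y`. -/
abbrev Tm.inst₂ {Γ : Ctx} {A A' : VTy} {j : Judg} (E : Tm (A' :: A :: Γ) j)
    (V : Val Γ A) (W : Val Γ A') : Tm Γ j :=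
  E.subst (Sub.cons W (Sub.cons V (fun _ x => .var x)))

/-- `S[M]`. -/
def Tm.plug {Γ : Ctx} {B C : CTy} : Stack Γ B C → Comp Γ B → Comp Γ C
  | .hole, M => M
  | .bindS S N, M => .bind (S.plug M) N
  | .appS S V, M => .app (S.plug M) V
  | .fstS S, M => .fst (S.plug M)
  | .sndS S, M => .snd (S.plug M)
  | .unrollS h S, M => .unroll h (S.plug M)

/-- `S[S']`. -/
def Tm.compS {Γ : Ctx} {B C D : CTy} : Stack Γ C D → Stack Γ B C → Stack Γ B D
  | .hole, T => T
  | .bindS S N, T => .bindS (S.compS T) N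
  | .appS S V, T => .appS (S.compS T) V
  | .fstS S, T => .fstS (S.compS T)
  | .sndS S, T => .sndS (S.compS T)
  | .unrollS h S, T => .unrollS h (S.compS T)

/-! ### Inequational theory -/

/-- The `β` contractions, with the number of (co)recursive type unrollings they count for. They are
both axioms of the inequational theory and the redexes of the operational semantics. -/
inductive Beta : {Γ : Ctx} → {B : CTy} → ℕ → Comp Γ B → Comp Γ B → Prop
  | caseInl {Γ : Ctx} {A A' : VTy} {B : CTy} (V : Val Γ A)
      (M : Comp (A :: Γ) B) (N : Comp (A' :: Γ) B) : Beta 0 (.case (.inl V) M N) (M.inst V)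
  | caseInr {Γ : Ctx} {A A' : VTy} {B : CTy} (V : Val Γ A')
      (M : Comp (A :: Γ) B) (N : Comp (A' :: Γ) B) : Beta 0 (.case (.inr V) M N) (N.inst V)
  | splitUnit {Γ : Ctx} {B : CTy} (M : Comp Γ B) : Beta 0 (.splitUnit .unit M) M
  | splitPair {Γ : Ctx} {A A' : VTy} {B : CTy} (V : Val Γ A) (W : Val Γ A')
      (M : Comp (A' :: A :: Γ) B) : Beta 0 (.splitPair (.pair V W) M) (M.inst₂ V W)
  | splitRoll {Γ : Ctx} {A : Ty [.val] .val} {B : CTy} (V : Val Γ (unfoldMu A))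
      (M : Comp (unfoldMu A :: Γ) B) : Beta 1 (.splitRoll (.rollMu V) M) (M.inst V)
  | force {Γ : Ctx} {B : CTy} (M : Comp Γ B) : Beta 0 (.force (.thunk M)) M
  | letv {Γ : Ctx} {A : VTy} {B : CTy} (V : Val Γ A) (M : Comp (A :: Γ) B) :
      Beta 0 (.letv V M) (M.inst V)
  | bind {Γ : Ctx} {A : VTy} {B : CTy} (V : Val Γ A) (M : Comp (A :: Γ) B) :
      Beta 0 (.bind (.ret V) M) (M.inst V)
  | app {Γ : Ctx} {A : VTy} {B : CTy} (M : Comp (A :: Γ) B) (V : Val Γ A) :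
      Beta 0 (.app (.lam M) V) (M.inst V)
  | fst {Γ : Ctx} {B B' : CTy} (M : Comp Γ B) (N : Comp Γ B') : Beta 0 (.fst (.cpair M N)) M
  | snd {Γ : Ctx} {B B' : CTy} (M : Comp Γ B) (N : Comp Γ B') : Beta 0 (.snd (.cpair M N)) N
  | unroll {Γ : Ctx} {B : Ty [.comp] .comp} (M : Comp Γ (unfoldNu B)) :
      Beta 1 (.unroll rfl (.rollNu M)) M

/-- `E[W/x]` where `Γ, x : A ⊢ E` and `Γ, x : A, y : A' ⊢ W : A`. -/
abbrev Tm.repl {Γ : Ctx} {A A' : VTy} {j : Judg} (E : Tm (A :: Γ) j)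
    (W : Val (A' :: A :: Γ) A) : Tm (A' :: A :: Γ) j :=
  E.subst (Sub.cons W (fun _ x => .var (.succ (.succ x))))

/-- The axioms `E ⊒⊑ E'` (to be read in both directions). -/
inductive EquiAx : {Γ : Ctx} → {j : Judg} → Tm Γ j → Tm Γ j → Prop
  | beta {Γ : Ctx} {B : CTy} {i : ℕ} {M N : Comp Γ B} : Beta i M N → EquiAx M N
  | etaZero {Γ : Ctx} {B : CTy} (M : Comp (.zero :: Γ) B) : EquiAx M (.abort (.var .zero))
  | etaSum {Γ : Ctx} {A A' : VTy} {B : CTy} (M : Comp (.sum A A' :: Γ) B) :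
      EquiAx M (.case (.var .zero)
        (M.repl (.inl (.var .zero))) (M.repl (.inr (.var .zero))))
  | etaOne {Γ : Ctx} {B : CTy} (M : Comp (.one :: Γ) B) : EquiAx M (M.inst .unit).wk
  | etaProd {Γ : Ctx} {A A' : VTy} {B : CTy} (M : Comp (.prod A A' :: Γ) B) :
      EquiAx M (.splitPair (.var .zero)
        (M.subst (Sub.cons (.pair (.var (.succ .zero)) (.var .zero))
          (fun _ x => .var (.succ (.succ (.succ x)))))))
  | etaMu {Γ : Ctx} {A : Ty [.val] .val} {B : CTy} (M : Comp (.mu A :: Γ) B) :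
      EquiAx M (.splitRoll (.var .zero) (M.repl (.rollMu (.var .zero))))
  | etaU {Γ : Ctx} {B : CTy} (V : Val Γ (.U B)) : EquiAx V (.thunk (.force V))
  /-- The `η` law of `F` for an arbitrary stack; for `S = •` it reads `• ⊒⊑ bind x ← •; ret x`. -/
  | etaF {Γ : Ctx} {A : VTy} {B : CTy} (S : Stack Γ (.F A) B) :
      EquiAx S (.bindS .hole (S.wk.plug (.ret (.var .zero))))
  | etaArr {Γ : Ctx} {A : VTy} {B : CTy} (M : Comp Γ (.arr A B)) :
      EquiAx M (.lam (.app M.wk (.var .zero)))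
  | etaAmp {Γ : Ctx} {B B' : CTy} (M : Comp Γ (.amp B B')) :
      EquiAx M (.cpair (.fst M) (.snd M))
  | etaTop {Γ : Ctx} (M : Comp Γ .top) : EquiAx M .triv
  | etaNu {Γ : Ctx} {B : Ty [.comp] .comp} (M : Comp Γ (.nu B)) :
      EquiAx M (.rollNu (.unroll rfl M))
  | strict {Γ : Ctx} {B C : CTy} (S : Stack Γ B C) : EquiAx (S.plug .err) .err

/-- Derivability of `Γ | Δ ⊢ E ⊑ E' : T`. -/
inductive Ineq : {Γ : Ctx} → {j : Judg} → Tm Γ j → Tm Γ j → Prop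
  | refl {Γ : Ctx} {j : Judg} (E : Tm Γ j) : Ineq E E
  | trans {Γ : Ctx} {j : Judg} {E₁ E₂ E₃ : Tm Γ j} : Ineq E₁ E₂ → Ineq E₂ E₃ → Ineq E₁ E₃
  | ax {Γ : Ctx} {j : Judg} {E E' : Tm Γ j} : EquiAx E E' → Ineq E E'
  | axOp {Γ : Ctx} {j : Judg} {E E' : Tm Γ j} : EquiAx E E' → Ineq E' E
  | errBot {Γ : Ctx} {B : CTy} (M : Comp Γ B) : Ineq .err M
  -- substitution and plugging
  | subst {Γ : Ctx} {A : VTy} {j : Judg} {E E' : Tm (A :: Γ) j} {V V' : Val Γ A} :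
      Ineq E E' → Ineq V V' → Ineq (E.inst V) (E'.inst V')
  | plug {Γ : Ctx} {B C : CTy} {S S' : Stack Γ B C} {M M' : Comp Γ B} :
      Ineq S S' → Ineq M M' → Ineq (S.plug M) (S'.plug M')
  | compS {Γ : Ctx} {B C D : CTy} {S S' : Stack Γ C D} {T T' : Stack Γ B C} :
      Ineq S S' → Ineq T T' → Ineq (S.compS T) (S'.compS T')
  -- congruence; the nullary constructors are instances of `refl`
  | rollMu {Γ : Ctx} {A : Ty [.val] .val} {V V' : Val Γ (unfoldMu A)} :
      Ineq V V' → Ineq (.rollMu V) (.rollMu V')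
  | inl {Γ : Ctx} {A A' : VTy} {V V' : Val Γ A} :
      Ineq V V' → Ineq (Tm.inl (A' := A') V) (.inl V')
  | inr {Γ : Ctx} {A A' : VTy} {V V' : Val Γ A'} :
      Ineq V V' → Ineq (Tm.inr (A := A) V) (.inr V')
  | pair {Γ : Ctx} {A A' : VTy} {V V' : Val Γ A} {W W' : Val Γ A'} :
      Ineq V V' → Ineq W W' → Ineq (.pair V W) (.pair V' W')
  | thunk {Γ : Ctx} {B : CTy} {M M' : Comp Γ B} : Ineq M M' → Ineq (.thunk M) (.thunk M')
  | letv {Γ : Ctx} {A : VTy} {B : CTy} {V V' : Val Γ A} {M M' : Comp (A :: Γ) B} :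
      Ineq V V' → Ineq M M' → Ineq (.letv V M) (.letv V' M')
  | abort {Γ : Ctx} {B : CTy} {V V' : Val Γ .zero} :
      Ineq V V' → Ineq (Tm.abort (B := B) V) (.abort V')
  | case {Γ : Ctx} {A A' : VTy} {B : CTy} {V V' : Val Γ (.sum A A')}
      {M M' : Comp (A :: Γ) B} {N N' : Comp (A' :: Γ) B} :
      Ineq V V' → Ineq M M' → Ineq N N' → Ineq (.case V M N) (.case V' M' N')
  | splitUnit {Γ : Ctx} {B : CTy} {V V' : Val Γ .one} {M M' : Comp Γ B} :
      Ineq V V' → Ineq M M' → Ineq (.splitUnit V M) (.splitUnit V' M')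
  | splitPair {Γ : Ctx} {A A' : VTy} {B : CTy} {V V' : Val Γ (.prod A A')}
      {M M' : Comp (A' :: A :: Γ) B} :
      Ineq V V' → Ineq M M' → Ineq (.splitPair V M) (.splitPair V' M')
  | splitRoll {Γ : Ctx} {A : Ty [.val] .val} {B : CTy} {V V' : Val Γ (.mu A)}
      {M M' : Comp (unfoldMu A :: Γ) B} :
      Ineq V V' → Ineq M M' → Ineq (.splitRoll V M) (.splitRoll V' M')
  | force {Γ : Ctx} {B : CTy} {V V' : Val Γ (.U B)} : Ineq V V' → Ineq (.force V) (.force V')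
  | ret {Γ : Ctx} {A : VTy} {V V' : Val Γ A} : Ineq V V' → Ineq (.ret V) (.ret V')
  | bind {Γ : Ctx} {A : VTy} {B : CTy} {M M' : Comp Γ (.F A)} {N N' : Comp (A :: Γ) B} :
      Ineq M M' → Ineq N N' → Ineq (.bind M N) (.bind M' N')
  | lam {Γ : Ctx} {A : VTy} {B : CTy} {M M' : Comp (A :: Γ) B} :
      Ineq M M' → Ineq (.lam M) (.lam M')
  | app {Γ : Ctx} {A : VTy} {B : CTy} {M M' : Comp Γ (.arr A B)} {V V' : Val Γ A} :
      Ineq M M' → Ineq V V' → Ineq (.app M V) (.app M' V')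
  | cpair {Γ : Ctx} {B B' : CTy} {M M' : Comp Γ B} {N N' : Comp Γ B'} :
      Ineq M M' → Ineq N N' → Ineq (.cpair M N) (.cpair M' N')
  | fst {Γ : Ctx} {B B' : CTy} {M M' : Comp Γ (.amp B B')} :
      Ineq M M' → Ineq (.fst M) (.fst M')
  | snd {Γ : Ctx} {B B' : CTy} {M M' : Comp Γ (.amp B B')} :
      Ineq M M' → Ineq (.snd M) (.snd M')
  | rollNu {Γ : Ctx} {B : Ty [.comp] .comp} {M M' : Comp Γ (unfoldNu B)} :
      Ineq M M' → Ineq (.rollNu M) (.rollNu M')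
  | unroll {Γ : Ctx} {B : Ty [.comp] .comp} {C : CTy} (h : C = unfoldNu B)
      {M M' : Comp Γ (.nu B)} : Ineq M M' → Ineq (.unroll h M) (.unroll h M')
  | bindS {Γ : Ctx} {A : VTy} {B C : CTy} {S S' : Stack Γ C (.F A)} {N N' : Comp (A :: Γ) B} :
      Ineq S S' → Ineq N N' → Ineq (.bindS S N) (.bindS S' N')
  | appS {Γ : Ctx} {A : VTy} {B C : CTy} {S S' : Stack Γ C (.arr A B)} {V V' : Val Γ A} :
      Ineq S S' → Ineq V V' → Ineq (.appS S V) (.appS S' V')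
  | fstS {Γ : Ctx} {B B' C : CTy} {S S' : Stack Γ C (.amp B B')} :
      Ineq S S' → Ineq (.fstS S) (.fstS S')
  | sndS {Γ : Ctx} {B B' C : CTy} {S S' : Stack Γ C (.amp B B')} :
      Ineq S S' → Ineq (.sndS S) (.sndS S')
  | unrollS {Γ : Ctx} {B : Ty [.comp] .comp} {C D : CTy} (h : D = unfoldNu B)
      {S S' : Stack Γ C (.nu B)} : Ineq S S' → Ineq (.unrollS h S) (.unrollS h S')

/-- Derivability of `Γ | Δ ⊢ E ⊒⊑ E' : T`. -/
def EquiIneq {Γ : Ctx} {j : Judg} (E E' : Tm Γ j) : Prop := Ineq E E' ∧ Ineq E' E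

/-! ### Operational semantics -/

/-- Small steps of whole programs. An error discards the (non-empty) stack around it;
the error itself is final. -/
inductive Step : ℕ → Program → Program → Prop
  | error {B : CTy} (S : Stack [] B (.F bool)) (h : S.plug .err ≠ .err) :
      Step 0 (S.plug .err) .err
  | beta {B : CTy} {i : ℕ} (S : Stack [] B (.F bool)) {M N : Comp [] B} :
      Beta i M N → Step i (S.plug M) (S.plug N)

inductive Steps : ℕ → Program → Program → Prop
  | refl (M : Program) : Steps 0 M M
  | step {i j : ℕ} {M₁ M₂ M₃ : Program} :
      Step i M₁ M₂ → Steps j M₂ M₃ → Steps (i + j) M₁ M₃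

/-- The possible results `Ω`, `℧`, `ret true`, `ret false`. -/
inductive Result : Type
  | diverge
  | error
  | tt
  | ff

/-- `M ⇑`, respectively `M ⇓ R`. -/
def HasResult (M : Program) : Result → Prop
  | .diverge => ∀ (i : ℕ) (N : Program), Steps i M N → ∃ (j : ℕ) (N' : Program), Step j N N'
  | .error => ∃ i : ℕ, Steps i M .err
  | .tt => ∃ i : ℕ, Steps i M (.ret (.inl .unit))
  | .ff => ∃ i : ℕ, Steps i M (.ret (.inr .unit))

/-! ### Every program has exactly one result -/

/-- The outcome of looking for a redex. -/
inductive Next (Γ : Ctx) (j : Judg) : Type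
  | none
  | err
  | step (i : ℕ) (E : Tm Γ j)

def Next.map {Γ : Ctx} {j k : Judg} (o : Next Γ j) (f : Tm Γ j → Tm Γ k) (d : Next Γ k) :
    Next Γ k :=
  match o with
  | .none => d
  | .err => .err
  | .step i E => .step i (f E)

def Tm.next {Γ : Ctx} {j : Judg} : Tm Γ j → Next Γ j
  | .err => .err
  | .letv V M => .step 0 (M.inst V)
  | .case V M N => match V with
    | .inl V => .step 0 (M.inst V)
    | .inr V => .step 0 (N.inst V)
    | _ => .none
  | .splitUnit V M => match V with
    | .unit => .step 0 M
    | _ => .none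
  | .splitPair V M => match V with
    | .pair V W => .step 0 (M.inst₂ V W)
    | _ => .none
  | .splitRoll V M => match V with
    | .rollMu V => .step 1 (M.inst V)
    | _ => .none
  | .force V => match V with
    | .thunk M => .step 0 M
    | _ => .none
  | .bind M N => M.next.map (fun M' => .bind M' N) (match M with
    | .ret V => .step 0 (N.inst V)
    | _ => .none)
  | .app M V => M.next.map (fun M' => .app M' V) (match M with
    | .lam M => .step 0 (M.inst V)
    | _ => .none)
  | .fst M => M.next.map (fun M' => .fst M') (match M with
    | .cpair M _ => .step 0 M
    | _ => .none)
  | .snd M => M.next.map (fun M' => .snd M') (match M with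
    | .cpair _ M => .step 0 M
    | _ => .none)
  | .unroll h M => M.next.map (fun M' => .unroll h M') (match M with
    | .rollNu M => .step 1 (h ▸ M)
    | _ => .none)
  | _ => .none

theorem Beta.next_eq {Γ : Ctx} {B : CTy} {i : ℕ} {M N : Comp Γ B} (h : Beta i M N) :
    M.next = .step i N := by
  cases h <;> rfl

theorem Tm.plug_next_err {Γ : Ctx} {B : CTy} : {C : CTy} → (S : Stack Γ B C) →
    (S.plug .err).next = .err
  | _, .hole => by simp only [Tm.plug]; rfl
  | _, .bindS S _ | _, .appS S _ | _, .fstS S | _, .sndS S | _, .unrollS _ S => by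
    simp only [Tm.plug]
    refine (show _ = Next.map _ _ _ from rfl).trans ?_
    rw [Tm.plug_next_err S]
    rfl

theorem Tm.plug_next_step {Γ : Ctx} {B : CTy} {i : ℕ} {M N : Comp Γ B}
    (h : M.next = .step i N) : {C : CTy} → (S : Stack Γ B C) →
    (S.plug M).next = .step i (S.plug N)
  | _, .hole => by simpa [Tm.plug] using h
  | _, .bindS S _ | _, .appS S _ | _, .fstS S | _, .sndS S | _, .unrollS _ S => by
    simp only [Tm.plug]
    refine (show _ = Next.map _ _ _ from rfl).trans ?_
    rw [Tm.plug_next_step h S]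
    rfl

theorem Step.next_eq {i : ℕ} {M N : Program} (h : Step i M N) :
    (M.next = .err ∧ i = 0 ∧ N = .err ∧ M ≠ .err) ∨ M.next = .step i N := by
  cases h with
  | error S h => exact .inl ⟨S.plug_next_err, rfl, rfl, h⟩
  | beta S h => exact .inr (Tm.plug_next_step h.next_eq S)

theorem Step.deterministic {i j : ℕ} {M N N' : Program} (h : Step i M N) (h' : Step j M N') :
    i = j ∧ N = N' := by
  have h₁ := h.next_eq
  have h₂ := h'.next_eq
  aesop

/-- Computations that wait for the stack around them. -/
inductive Waits : {Γ : Ctx} → {j : Judg} → Tm Γ j → Prop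
  | ret {Γ : Ctx} {A : VTy} (V : Val Γ A) : Waits (.ret V)
  | lam {Γ : Ctx} {A : VTy} {B : CTy} (M : Comp (A :: Γ) B) : Waits (.lam M)
  | triv {Γ : Ctx} : Waits (Tm.triv (Γ := Γ))
  | cpair {Γ : Ctx} {B B' : CTy} (M : Comp Γ B) (N : Comp Γ B') : Waits (.cpair M N)
  | rollNu {Γ : Ctx} {B : Ty [.comp] .comp} (M : Comp Γ (unfoldNu B)) : Waits (.rollNu M)

/-- The ways in which a closed computation can be about to proceed. -/
def Ready {C : CTy} (M : Comp [] C) : Prop :=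
  Waits M ∨ (∃ (B : CTy) (S : Stack [] B C), M = S.plug .err) ∨
    ∃ (B : CTy) (S : Stack [] B C) (i : ℕ) (N N' : Comp [] B), M = S.plug N ∧ Beta i N N'

theorem Ready.of_beta {C : CTy} {i : ℕ} {M N : Comp [] C} (h : Beta i M N) : Ready M :=
  .inr (.inr ⟨C, .hole, i, M, N, by simp [Tm.plug], h⟩)

theorem Ready.extend {C D : CTy} {M : Comp [] C} (T : Stack [] C D) (h : Ready M)
    (hw : Waits M → Ready (T.plug M))
    (hp : ∀ (B : CTy) (S : Stack [] B C) (N : Comp [] B),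
      T.plug (S.plug N) = (T.compS S).plug N) : Ready (T.plug M) := by
  rcases h with h | ⟨B, S, rfl⟩ | ⟨B, S, i, N, N', rfl, h⟩
  · exact hw h
  · exact .inr (.inl ⟨B, T.compS S, hp _ _ _⟩)
  · exact .inr (.inr ⟨B, T.compS S, i, N, N', hp _ _ _, h⟩)

theorem Tm.ready : {C : CTy} → (M : Comp [] C) → Ready M
  | C, .err => .inr (.inl ⟨C, .hole, by simp [Tm.plug]⟩)
  | _, .letv V M => .of_beta (.letv V M)
  | _, .abort V => by cases V with | var x => cases x
  | _, .case V M N => by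
    cases V with
    | var x => cases x
    | inl V => exact .of_beta (.caseInl V M N)
    | inr V => exact .of_beta (.caseInr V M N)
  | _, .splitUnit V M => by
    cases V with
    | var x => cases x
    | unit => exact .of_beta (.splitUnit M)
  | _, .splitPair V M => by
    cases V with
    | var x => cases x
    | pair V W => exact .of_beta (.splitPair V W M)
  | _, .splitRoll V M => by
    cases V with
    | var x => cases x
    | rollMu V => exact .of_beta (.splitRoll V M)
  | _, .force V => by
    cases V with
    | var x => cases x
    | thunk M => exact .of_beta (.force M)
  | _, .ret V => .inl (.ret V)
  | _, .lam M => .inl (.lam M)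
  | _, .triv => .inl .triv
  | _, .cpair M N => .inl (.cpair M N)
  | _, .rollNu M => .inl (.rollNu M)
  | _, .bind M N => by
    simpa [Tm.plug] using M.ready.extend (.bindS .hole N) (fun h => by
      cases h with | ret V => simpa [Tm.plug] using Ready.of_beta (.bind V N))
      (by simp [Tm.plug, Tm.compS])
  | _, .app M V => by
    simpa [Tm.plug] using M.ready.extend (.appS .hole V) (fun h => by
      cases h with | lam M => simpa [Tm.plug] using Ready.of_beta (.app M V))
      (by simp [Tm.plug, Tm.compS])
  | _, .fst M => by
    simpa [Tm.plug] using M.ready.extend (.fstS .hole) (fun h => by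
      cases h with | cpair M N => simpa [Tm.plug] using Ready.of_beta (.fst M N))
      (by simp [Tm.plug, Tm.compS])
  | _, .snd M => by
    simpa [Tm.plug] using M.ready.extend (.sndS .hole) (fun h => by
      cases h with | cpair M N => simpa [Tm.plug] using Ready.of_beta (.snd M N))
      (by simp [Tm.plug, Tm.compS])
  | _, .unroll h M => by
    simpa [Tm.plug] using M.ready.extend (.unrollS h .hole) (fun h' => by
      subst h
      cases h' with | rollNu M => simpa [Tm.plug] using Ready.of_beta (.unroll M))
      (by simp [Tm.plug, Tm.compS])

theorem Program.progress (M : Program) :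
    M = .err ∨ M = .ret (.inl .unit) ∨ M = .ret (.inr .unit) ∨ ∃ i N, Step i M N := by
  rcases M.ready with h | ⟨B, S, rfl⟩ | ⟨B, S, i, N, N', rfl, h⟩
  · cases h with
    | ret V =>
      cases V with
      | var x => cases x
      | inl V =>
        cases V with
        | var x => cases x
        | unit => simp
      | inr V =>
        cases V with
        | var x => cases x
        | unit => simp
  · by_cases h : S.plug .err = .err
    · exact .inl h
    · exact .inr (.inr (.inr ⟨0, _, .error S h⟩))
  · exact .inr (.inr (.inr ⟨i, _, .beta S h⟩))

/-- Programs that do not step. -/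
def Final (M : Program) : Prop := ∀ (i : ℕ) (N : Program), ¬ Step i M N

theorem Final.err : Final .err := fun i N h => by
  rcases h.next_eq with h | h
  · exact h.2.2.2 rfl
  · cases (show Next.err = _ from h)

theorem Final.ret (V : Val [] bool) : Final (.ret V) := fun i N h => by
  rcases h.next_eq with h | h
  · cases (show Next.none = _ from h.1)
  · cases (show Next.none = _ from h)

theorem Steps.final_unique {i j : ℕ} {M N N' : Program} (h : Steps i M N) (h' : Steps j M N')
    (hN : Final N) (hN' : Final N') : N = N' := by
  induction h generalizing j with
  | refl M =>
    cases h' with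
    | refl => rfl
    | step s _ => exact (hN _ _ s).elim
  | step s _ ih =>
    cases h' with
    | refl => exact (hN' _ _ s).elim
    | step s' t =>
      obtain ⟨-, rfl⟩ := s.deterministic s'
      exact ih t hN

theorem HasResult.unique {M : Program} {R R' : Result} (h : HasResult M R)
    (h' : HasResult M R') : R = R' := by
  have key : ∀ {N : Program} {i : ℕ}, Final N → Steps i M N → ¬ HasResult M .diverge :=
    fun hN s hd => by
      obtain ⟨j, N', t⟩ := hd _ _ s
      exact hN _ _ t
  cases R <;> cases R' <;> first
    | rfl
    | (obtain ⟨i, s⟩ := h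
       obtain ⟨j, t⟩ := h'
       have := s.final_unique t (by first | exact .err | exact .ret _)
         (by first | exact .err | exact .ret _)
       simp at this)
    | (obtain ⟨i, s⟩ := h
       exact (key (by first | exact .err | exact .ret _) s h').elim)
    | (obtain ⟨i, s⟩ := h'
       exact (key (by first | exact .err | exact .ret _) s h).elim)

theorem exists_hasResult (M : Program) : ∃ R, HasResult M R := by
  by_cases h : HasResult M .diverge
  · exact ⟨_, h⟩
  · simp only [HasResult, not_forall] at h
    obtain ⟨i, N, s, hN⟩ := h
    rcases N.progress with rfl | rfl | rfl | ⟨j, N', t⟩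
    · exact ⟨.error, i, s⟩
    · exact ⟨.tt, i, s⟩
    · exact ⟨.ff, i, s⟩
    · exact (hN ⟨j, N', t⟩).elim

/-- The end-behaviour of a program. -/
noncomputable def result (M : Program) : Result := (exists_hasResult M).choose

theorem hasResult_iff {M : Program} {R : Result} : HasResult M R ↔ result M = R :=
  ⟨fun h => (exists_hasResult M).choose_spec.unique h,
    fun h => h ▸ (exists_hasResult M).choose_spec⟩

/-! ### Contexts -/

/-- `Con Γ₀ j₀ Γ j` are the contexts `C : (Γ₀ ⊢ j₀) ⇒ (Γ ⊢ j)`: values, computations or stacks of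
type `j` in `Γ` with a single typed hole.

The hole may lie under binders of other variables than those of `Γ₀`, bound in any order; with de
Bruijn indices, an injective map sends the variables of `Γ₀` to the variables in scope at the hole.
As stacks are not subterms of computations, a context with a hole for a stack is turned into
a computation by running the resulting stack on some computation (`run`). -/
inductive Con (Γ₀ : Ctx) (j₀ : Judg) : Ctx → Judg → Type
  | here {Γ : Ctx} (ρ : Ren Γ₀ Γ) (hρ : ∀ A, Function.Injective (ρ A)) : Con Γ₀ j₀ Γ j₀
  -- values
  | rollMu {Γ : Ctx} {A : Ty [.val] .val} :
      Con Γ₀ j₀ Γ (.val (unfoldMu A)) → Con Γ₀ j₀ Γ (.val (.mu A))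
  | inl {Γ : Ctx} {A A' : VTy} : Con Γ₀ j₀ Γ (.val A) → Con Γ₀ j₀ Γ (.val (.sum A A'))
  | inr {Γ : Ctx} {A A' : VTy} : Con Γ₀ j₀ Γ (.val A') → Con Γ₀ j₀ Γ (.val (.sum A A'))
  | pairL {Γ : Ctx} {A A' : VTy} :
      Con Γ₀ j₀ Γ (.val A) → Val Γ A' → Con Γ₀ j₀ Γ (.val (.prod A A'))
  | pairR {Γ : Ctx} {A A' : VTy} :
      Val Γ A → Con Γ₀ j₀ Γ (.val A') → Con Γ₀ j₀ Γ (.val (.prod A A'))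
  | thunk {Γ : Ctx} {B : CTy} : Con Γ₀ j₀ Γ (.comp B) → Con Γ₀ j₀ Γ (.val (.U B))
  -- computations
  | letvL {Γ : Ctx} {A : VTy} {B : CTy} :
      Con Γ₀ j₀ Γ (.val A) → Comp (A :: Γ) B → Con Γ₀ j₀ Γ (.comp B)
  | letvR {Γ : Ctx} {A : VTy} {B : CTy} :
      Val Γ A → Con Γ₀ j₀ (A :: Γ) (.comp B) → Con Γ₀ j₀ Γ (.comp B)
  | abort {Γ : Ctx} {B : CTy} : Con Γ₀ j₀ Γ (.val .zero) → Con Γ₀ j₀ Γ (.comp B)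
  | case₀ {Γ : Ctx} {A A' : VTy} {B : CTy} : Con Γ₀ j₀ Γ (.val (.sum A A')) →
      Comp (A :: Γ) B → Comp (A' :: Γ) B → Con Γ₀ j₀ Γ (.comp B)
  | case₁ {Γ : Ctx} {A A' : VTy} {B : CTy} : Val Γ (.sum A A') →
      Con Γ₀ j₀ (A :: Γ) (.comp B) → Comp (A' :: Γ) B → Con Γ₀ j₀ Γ (.comp B)
  | case₂ {Γ : Ctx} {A A' : VTy} {B : CTy} : Val Γ (.sum A A') →
      Comp (A :: Γ) B → Con Γ₀ j₀ (A' :: Γ) (.comp B) → Con Γ₀ j₀ Γ (.comp B)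
  | splitUnitL {Γ : Ctx} {B : CTy} :
      Con Γ₀ j₀ Γ (.val .one) → Comp Γ B → Con Γ₀ j₀ Γ (.comp B)
  | splitUnitR {Γ : Ctx} {B : CTy} :
      Val Γ .one → Con Γ₀ j₀ Γ (.comp B) → Con Γ₀ j₀ Γ (.comp B)
  | splitPairL {Γ : Ctx} {A A' : VTy} {B : CTy} : Con Γ₀ j₀ Γ (.val (.prod A A')) →
      Comp (A' :: A :: Γ) B → Con Γ₀ j₀ Γ (.comp B)
  | splitPairR {Γ : Ctx} {A A' : VTy} {B : CTy} : Val Γ (.prod A A') →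
      Con Γ₀ j₀ (A' :: A :: Γ) (.comp B) → Con Γ₀ j₀ Γ (.comp B)
  | splitRollL {Γ : Ctx} {A : Ty [.val] .val} {B : CTy} : Con Γ₀ j₀ Γ (.val (.mu A)) →
      Comp (unfoldMu A :: Γ) B → Con Γ₀ j₀ Γ (.comp B)
  | splitRollR {Γ : Ctx} {A : Ty [.val] .val} {B : CTy} : Val Γ (.mu A) →
      Con Γ₀ j₀ (unfoldMu A :: Γ) (.comp B) → Con Γ₀ j₀ Γ (.comp B)
  | force {Γ : Ctx} {B : CTy} : Con Γ₀ j₀ Γ (.val (.U B)) → Con Γ₀ j₀ Γ (.comp B)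
  | ret {Γ : Ctx} {A : VTy} : Con Γ₀ j₀ Γ (.val A) → Con Γ₀ j₀ Γ (.comp (.F A))
  | bindL {Γ : Ctx} {A : VTy} {B : CTy} :
      Con Γ₀ j₀ Γ (.comp (.F A)) → Comp (A :: Γ) B → Con Γ₀ j₀ Γ (.comp B)
  | bindR {Γ : Ctx} {A : VTy} {B : CTy} :
      Comp Γ (.F A) → Con Γ₀ j₀ (A :: Γ) (.comp B) → Con Γ₀ j₀ Γ (.comp B)
  | lam {Γ : Ctx} {A : VTy} {B : CTy} :
      Con Γ₀ j₀ (A :: Γ) (.comp B) → Con Γ₀ j₀ Γ (.comp (.arr A B))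
  | appL {Γ : Ctx} {A : VTy} {B : CTy} :
      Con Γ₀ j₀ Γ (.comp (.arr A B)) → Val Γ A → Con Γ₀ j₀ Γ (.comp B)
  | appR {Γ : Ctx} {A : VTy} {B : CTy} :
      Comp Γ (.arr A B) → Con Γ₀ j₀ Γ (.val A) → Con Γ₀ j₀ Γ (.comp B)
  | cpairL {Γ : Ctx} {B B' : CTy} :
      Con Γ₀ j₀ Γ (.comp B) → Comp Γ B' → Con Γ₀ j₀ Γ (.comp (.amp B B'))
  | cpairR {Γ : Ctx} {B B' : CTy} :
      Comp Γ B → Con Γ₀ j₀ Γ (.comp B') → Con Γ₀ j₀ Γ (.comp (.amp B B'))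
  | fst {Γ : Ctx} {B B' : CTy} : Con Γ₀ j₀ Γ (.comp (.amp B B')) → Con Γ₀ j₀ Γ (.comp B)
  | snd {Γ : Ctx} {B B' : CTy} : Con Γ₀ j₀ Γ (.comp (.amp B B')) → Con Γ₀ j₀ Γ (.comp B')
  | rollNu {Γ : Ctx} {B : Ty [.comp] .comp} :
      Con Γ₀ j₀ Γ (.comp (unfoldNu B)) → Con Γ₀ j₀ Γ (.comp (.nu B))
  | unroll {Γ : Ctx} {B : Ty [.comp] .comp} {C : CTy} (h : C = unfoldNu B) :
      Con Γ₀ j₀ Γ (.comp (.nu B)) → Con Γ₀ j₀ Γ (.comp C)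
  | run {Γ : Ctx} {B C : CTy} : Con Γ₀ j₀ Γ (.stk B C) → Comp Γ B → Con Γ₀ j₀ Γ (.comp C)
  -- stacks
  | bindSL {Γ : Ctx} {A : VTy} {B C : CTy} :
      Con Γ₀ j₀ Γ (.stk C (.F A)) → Comp (A :: Γ) B → Con Γ₀ j₀ Γ (.stk C B)
  | bindSR {Γ : Ctx} {A : VTy} {B C : CTy} :
      Stack Γ C (.F A) → Con Γ₀ j₀ (A :: Γ) (.comp B) → Con Γ₀ j₀ Γ (.stk C B)
  | appSL {Γ : Ctx} {A : VTy} {B C : CTy} :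
      Con Γ₀ j₀ Γ (.stk C (.arr A B)) → Val Γ A → Con Γ₀ j₀ Γ (.stk C B)
  | appSR {Γ : Ctx} {A : VTy} {B C : CTy} :
      Stack Γ C (.arr A B) → Con Γ₀ j₀ Γ (.val A) → Con Γ₀ j₀ Γ (.stk C B)
  | fstS {Γ : Ctx} {B B' C : CTy} :
      Con Γ₀ j₀ Γ (.stk C (.amp B B')) → Con Γ₀ j₀ Γ (.stk C B)
  | sndS {Γ : Ctx} {B B' C : CTy} :
      Con Γ₀ j₀ Γ (.stk C (.amp B B')) → Con Γ₀ j₀ Γ (.stk C B')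
  | unrollS {Γ : Ctx} {B : Ty [.comp] .comp} {C D : CTy} (h : D = unfoldNu B) :
      Con Γ₀ j₀ Γ (.stk C (.nu B)) → Con Γ₀ j₀ Γ (.stk C D)

/-- `C[E]`. -/
def Con.fill {Γ₀ Γ : Ctx} {j₀ j : Judg} : Con Γ₀ j₀ Γ j → Tm Γ₀ j₀ → Tm Γ j
  | .here ρ _, E => E.rename ρ
  | .rollMu C, E => .rollMu (C.fill E)
  | .inl C, E => .inl (C.fill E)
  | .inr C, E => .inr (C.fill E)
  | .pairL C W, E => .pair (C.fill E) W
  | .pairR V C, E => .pair V (C.fill E)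
  | .thunk C, E => .thunk (C.fill E)
  | .letvL C M, E => .letv (C.fill E) M
  | .letvR V C, E => .letv V (C.fill E)
  | .abort C, E => .abort (C.fill E)
  | .case₀ C M N, E => .case (C.fill E) M N
  | .case₁ V C N, E => .case V (C.fill E) N
  | .case₂ V M C, E => .case V M (C.fill E)
  | .splitUnitL C M, E => .splitUnit (C.fill E) M
  | .splitUnitR V C, E => .splitUnit V (C.fill E)
  | .splitPairL C M, E => .splitPair (C.fill E) M
  | .splitPairR V C, E => .splitPair V (C.fill E)
  | .splitRollL C M, E => .splitRoll (C.fill E) M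
  | .splitRollR V C, E => .splitRoll V (C.fill E)
  | .force C, E => .force (C.fill E)
  | .ret C, E => .ret (C.fill E)
  | .bindL C N, E => .bind (C.fill E) N
  | .bindR M C, E => .bind M (C.fill E)
  | .lam C, E => .lam (C.fill E)
  | .appL C V, E => .app (C.fill E) V
  | .appR M C, E => .app M (C.fill E)
  | .cpairL C N, E => .cpair (C.fill E) N
  | .cpairR M C, E => .cpair M (C.fill E)
  | .fst C, E => .fst (C.fill E)
  | .snd C, E => .snd (C.fill E)
  | .rollNu C, E => .rollNu (C.fill E)
  | .unroll h C, E => .unroll h (C.fill E)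
  | .run C M, E => (C.fill E).plug M
  | .bindSL C N, E => .bindS (C.fill E) N
  | .bindSR S C, E => .bindS S (C.fill E)
  | .appSL C V, E => .appS (C.fill E) V
  | .appSR S C, E => .appS S (C.fill E)
  | .fstS C, E => .fstS (C.fill E)
  | .sndS C, E => .sndS (C.fill E)
  | .unrollS h C, E => .unrollS h (C.fill E)

/-! ### Contextual lifting -/

/-- Error approximation of results: `℧` is least, and the other three results are maximal and
unrelated. -/
inductive ErrLe : Result → Result → Prop
  | error (R : Result) : ErrLe .error R
  | refl (R : Result) : ErrLe R R

/-- The observational lift of a relation on results: `C[E]` and `C[E']` have related results for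
all closing contexts `C : (Γ | Δ ⊢ T) ⇒ (· ⊢ F 2)`. -/
def CtxLift (rel : Result → Result → Prop) {Γ : Ctx} {j : Judg} (E E' : Tm Γ j) : Prop :=
  ∀ C : Con Γ j [] (.comp (.F bool)), rel (result (C.fill E)) (result (C.fill E'))

end CBPV

/-!
The proof uses a step-indexed, biorthogonal logical relation. Values of each closed type are related
by their shape (`VRel`), stacks from each closed computation type to `F 2` by the elimination form
they start with, or, at `F A`, by what they do to returned values (`SRel`), and computations are
related if they behave alike under related stacks (`CRel`). The index counts unrollings of recursive
types; it makes the definition well-founded, since `μ` and `ν` refer to their unfoldings at smaller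
indices only. The relation is extended to open terms by closing substitutions (`TmRel`).

What it means to behave alike is a parameter (`Pole`), a step-indexed relation on programs. An index
bounds the run of one program only, so two poles are needed: `Pole.left` says that what the left
program returns is returned by the right one, `Pole.right` that the left program follows the right
one or ends with an error. Together they amount to error approximation of results.

For every pole, the relation is closed under all term formers. Hence it is reflexive
(`TmRel.refl`), closed under contexts (`TmRel.fill`), and contains all axioms in both directions
(`TmRel.equiAx`): `β` laws and `η` laws of positive types hold because their closing instances are
contractions, and `η` laws of negative types because related stacks start with an elimination form.
Relations at a fixed index do not compose, so transitivity is not shown for the logical relation.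
Instead, its transitive closure, which is closed under the same operations, contains derivable
inequality (`Ineq.transGen`); contexts carry a chain of related terms to a chain of related
programs, and there each observation, taken at all indices, is transitive (`ErrLe.of_transGen`).
-/

namespace CBPV

/-! ### Renaming, substitution and plugging -/

theorem Ren.lift_comp {Γ Δ Ξ : Ctx} {A : VTy} (ρ : Ren Γ Δ) (τ : Ren Δ Ξ) :
    (fun a x => Ren.lift (b := A) τ a (ρ.lift a x)) = Ren.lift (fun a x => τ a (ρ a x)) := by
  funext a x
  cases x <;> rfl

theorem Tm.rename_rename {Γ : Ctx} {j : Judg} (E : Tm Γ j) {Δ Ξ : Ctx} (ρ : Ren Γ Δ)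
    (τ : Ren Δ Ξ) : (E.rename ρ).rename τ = E.rename (fun a x => τ a (ρ a x)) := by
  induction E generalizing Δ Ξ <;>
    simp only [Tm.rename, Ren.lift_comp, *]

theorem Sub.lift_comp_ren {Γ Δ Ξ : Ctx} {A : VTy} (ρ : Ren Γ Δ) (σ : Sub Δ Ξ) :
    (fun a x => Sub.lift (A := A) σ a (ρ.lift a x)) = Sub.lift (fun a x => σ a (ρ a x)) := by
  funext a x
  cases x <;> rfl

theorem Tm.subst_rename {Γ : Ctx} {j : Judg} (E : Tm Γ j) {Δ Ξ : Ctx} (ρ : Ren Γ Δ)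
    (σ : Sub Δ Ξ) : (E.rename ρ).subst σ = E.subst (fun a x => σ a (ρ a x)) := by
  induction E generalizing Δ Ξ <;>
    simp only [Tm.rename, Tm.subst, Sub.lift_comp_ren, *]

theorem Sub.ren_comp_lift {Γ Δ Ξ : Ctx} {A : VTy} (σ : Sub Γ Δ) (ρ : Ren Δ Ξ) :
    (fun a x => (Sub.lift (A := A) σ a x).rename ρ.lift) =
      Sub.lift (fun a x => (σ a x).rename ρ) := by
  funext a x
  cases x with
  | zero => rfl
  | succ x => simp only [Sub.lift, Tm.wk, Tm.rename_rename, Ren.lift]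

theorem Tm.rename_subst {Γ : Ctx} {j : Judg} (E : Tm Γ j) {Δ Ξ : Ctx} (σ : Sub Γ Δ)
    (ρ : Ren Δ Ξ) : (E.subst σ).rename ρ = E.subst (fun a x => (σ a x).rename ρ) := by
  induction E generalizing Δ Ξ <;>
    simp only [Tm.rename, Tm.subst, Sub.ren_comp_lift, *]

theorem Sub.lift_comp {Γ Δ Ξ : Ctx} {A : VTy} (σ : Sub Γ Δ) (τ : Sub Δ Ξ) :
    (fun a x => (Sub.lift (A := A) σ a x).subst τ.lift) =
      Sub.lift (fun a x => (σ a x).subst τ) := by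
  funext a x
  cases x with
  | zero => rfl
  | succ x => simp only [Sub.lift, Tm.wk, Tm.rename_subst, Tm.subst_rename]

theorem Tm.subst_subst {Γ : Ctx} {j : Judg} (E : Tm Γ j) {Δ Ξ : Ctx} (σ : Sub Γ Δ)
    (τ : Sub Δ Ξ) : (E.subst σ).subst τ = E.subst (fun a x => (σ a x).subst τ) := by
  induction E generalizing Δ Ξ <;>
    simp only [Tm.subst, Sub.lift_comp, *]

theorem Sub.lift_id {Γ : Ctx} {A : VTy} :
    Sub.lift (A := A) (fun _ x => .var x : Sub Γ Γ) = fun _ x => .var x := by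
  funext a x
  cases x <;> rfl

theorem Tm.subst_id {Γ : Ctx} {j : Judg} (E : Tm Γ j) : E.subst (fun _ x => .var x) = E := by
  induction E <;>
    simp only [Tm.subst, Sub.lift_id, *]

theorem Sub.subst_cons {Γ Δ Ξ : Ctx} {A : VTy} (V : Val Δ A) (σ : Sub Γ Δ) (τ : Sub Δ Ξ) :
    (fun a x => (Sub.cons V σ a x).subst τ) =
      Sub.cons (V.subst τ) (fun a x => (σ a x).subst τ) := by
  funext a x
  cases x <;> rfl

theorem Sub.lift_subst_cons {Γ Δ Ξ : Ctx} {A : VTy} (σ : Sub Γ Δ) (V : Val Ξ A) (τ : Sub Δ Ξ) :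
    (fun a x => (σ.lift a x).subst (Sub.cons V τ)) =
      Sub.cons V (fun a x => (σ a x).subst τ) := by
  funext a x
  cases x with
  | zero => rfl
  | succ x => simp only [Sub.lift, Tm.wk, Tm.subst_rename, Sub.cons]

theorem Tm.inst_subst_lift {Γ Δ : Ctx} {A : VTy} {j : Judg} (E : Tm (A :: Γ) j) (σ : Sub Γ Δ)
    (V : Val Δ A) : (E.subst σ.lift).inst V = E.subst (Sub.cons V σ) := by
  simp only [Tm.inst, Tm.subst_subst, Sub.lift_subst_cons, Tm.subst_id]

theorem Tm.inst₂_subst_lift {Γ Δ : Ctx} {A A' : VTy} {j : Judg} (E : Tm (A' :: A :: Γ) j)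
    (σ : Sub Γ Δ) (V : Val Δ A) (W : Val Δ A') :
    (E.subst σ.lift.lift).inst₂ V W = E.subst (Sub.cons W (Sub.cons V σ)) := by
  simp only [Tm.inst₂, Tm.subst_subst, Sub.lift_subst_cons, Tm.subst_id]

theorem Tm.subst_inst {Γ Δ : Ctx} {A : VTy} {j : Judg} (E : Tm (A :: Γ) j) (V : Val Γ A)
    (σ : Sub Γ Δ) : (E.inst V).subst σ = E.subst (Sub.cons (V.subst σ) σ) := by
  simp only [Tm.inst, Tm.subst_subst, Sub.subst_cons]
  rfl

theorem Tm.subst_inst₂ {Γ Δ : Ctx} {A A' : VTy} {j : Judg} (E : Tm (A' :: A :: Γ) j)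
    (V : Val Γ A) (W : Val Γ A') (σ : Sub Γ Δ) :
    (E.inst₂ V W).subst σ = E.subst (Sub.cons (W.subst σ) (Sub.cons (V.subst σ) σ)) := by
  simp only [Tm.inst₂, Tm.subst_subst, Sub.subst_cons]
  rfl

theorem Tm.wk_subst_cons {Γ Δ : Ctx} {A : VTy} {j : Judg} (E : Tm Γ j) (V : Val Δ A)
    (σ : Sub Γ Δ) : E.wk.subst (Sub.cons V σ) = E.subst σ := by
  rw [Tm.wk, Tm.subst_rename]
  rfl

theorem Tm.subst_plug {Γ Δ : Ctx} {B : CTy} (σ : Sub Γ Δ) : {C : CTy} → (S : Stack Γ B C) →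
    (M : Comp Γ B) → (S.plug M).subst σ = (S.subst σ).plug (M.subst σ)
  | _, .hole, _ => by simp [Tm.plug, Tm.subst]
  | _, .bindS S _, M | _, .appS S _, M | _, .fstS S, M | _, .sndS S, M | _, .unrollS _ S, M => by
    simp only [Tm.plug, Tm.subst, Tm.subst_plug σ S M]

theorem Tm.subst_compS {Γ Δ : Ctx} {B C : CTy} (σ : Sub Γ Δ) : {D : CTy} → (S : Stack Γ C D) →
    (T : Stack Γ B C) → (S.compS T).subst σ = (S.subst σ).compS (T.subst σ)
  | _, .hole, _ => by simp [Tm.compS, Tm.subst]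
  | _, .bindS S _, M | _, .appS S _, M | _, .fstS S, M | _, .sndS S, M | _, .unrollS _ S, M => by
    simp only [Tm.compS, Tm.subst, Tm.subst_compS σ S M]

theorem Tm.compS_plug {Γ : Ctx} {B C : CTy} : {D : CTy} → (S : Stack Γ C D) →
    (T : Stack Γ B C) → (M : Comp Γ B) → (S.compS T).plug M = S.plug (T.plug M)
  | _, .hole, _, _ => by simp [Tm.compS, Tm.plug]
  | _, .bindS S _, T, M | _, .appS S _, T, M | _, .fstS S, T, M | _, .sndS S, T, M
  | _, .unrollS _ S, T, M => by
    simp only [Tm.compS, Tm.plug, Tm.compS_plug S T M]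

theorem Tm.compS_assoc {Γ : Ctx} {B C D : CTy} : {D' : CTy} → (S : Stack Γ D D') →
    (T : Stack Γ C D) → (K : Stack Γ B C) → (S.compS T).compS K = S.compS (T.compS K)
  | _, .hole, _, _ => by simp [Tm.compS]
  | _, .bindS S _, T, M | _, .appS S _, T, M | _, .fstS S, T, M | _, .sndS S, T, M
  | _, .unrollS _ S, T, M => by
    simp only [Tm.compS, Tm.compS_assoc S T M]

theorem Tm.compS_hole {Γ : Ctx} {B : CTy} : {C : CTy} → (S : Stack Γ B C) → S.compS .hole = S
  | _, .hole => by simp [Tm.compS]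
  | _, .bindS S _ | _, .appS S _ | _, .fstS S | _, .sndS S | _, .unrollS _ S => by
    simp only [Tm.compS, Tm.compS_hole S]

/-! ### Observations -/

/-- A step-indexed observation on pairs of programs, with the closure properties that the logical
relation needs. `β` contractions on either side can be undone at the same index, and if both sides
unroll a recursive type, the index may even increase. -/
structure Pole where
  rel : ℕ → Program → Program → Prop
  zero : ∀ M M', rel 0 M M'
  mono : ∀ {m n M M'}, m ≤ n → rel n M M' → rel m M M'
  betaL : ∀ {n B i} {M N : Comp [] B} (S : Stack [] B (.F bool)) {M' : Program},
    Beta i M N → rel n (S.plug N) M' → rel n (S.plug M) M'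
  betaR : ∀ {n B i} {M N : Comp [] B} (S : Stack [] B (.F bool)) {M' : Program},
    Beta i M N → rel n M' (S.plug N) → rel n M' (S.plug M)
  unroll : ∀ {n B B'} {M N : Comp [] B} {M' N' : Comp [] B'}
    (S : Stack [] B (.F bool)) (S' : Stack [] B' (.F bool)),
    Beta 1 M N → Beta 1 M' N' → rel n (S.plug N) (S'.plug N') →
      rel (n + 1) (S.plug M) (S'.plug M')
  err : ∀ {n B} (S : Stack [] B (.F bool)) (M' : Program), rel n (S.plug .err) M'
  tt : ∀ n, rel n (.ret (.inl .unit)) (.ret (.inl .unit))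
  ff : ∀ n, rel n (.ret (.inr .unit)) (.ret (.inr .unit))

/-! ### The logical relation -/

mutual

/-- Related closed values. At `U B` the relation is stated through `force`, which makes the `η` law
of `U` an instance of `β`. The recursion is well-founded because the index decreases at recursive
types and the type everywhere else. -/
def VRel (P : Pole) (n : ℕ) : (A : VTy) → Val [] A → Val [] A → Prop
  | .var _, _, _ => False
  | .mu A, V, V' => ∃ W W', V = .rollMu W ∧ V' = .rollMu W' ∧
      ∀ m, (_ : m < n) → VRel P m (unfoldMu A) W W'
  | .U B, V, V' => ∀ m, (_ : m ≤ n) → ∀ S S', SRel P m B S S' →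
      P.rel m (S.plug (.force V)) (S'.plug (.force V'))
  | .zero, _, _ => False
  | .sum A A', V, V' => (∃ W W', V = .inl W ∧ V' = .inl W' ∧ VRel P n A W W') ∨
      ∃ W W', V = .inr W ∧ V' = .inr W' ∧ VRel P n A' W W'
  | .one, V, V' => V = .unit ∧ V' = .unit
  | .prod A A', V, V' => ∃ W₁ W₂ W₁' W₂', V = .pair W₁ W₂ ∧ V' = .pair W₁' W₂' ∧
      VRel P n A W₁ W₁' ∧ VRel P n A' W₂ W₂'
termination_by A => (n, sizeOf A)
decreasing_by
  all_goals first
    | exact Prod.Lex.left _ _ ‹_›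
    | (rcases Nat.lt_or_eq_of_le ‹_ ≤ _› with h | rfl
       · exact Prod.Lex.left _ _ h
       · exact Prod.Lex.right _ (by simp; try omega))
    | exact Prod.Lex.right _ (by simp; try omega)

/-- Related closed stacks: a stack on a negative type starts with an elimination form, and stacks on
`F A` are those which do related things to returned related values. -/
def SRel (P : Pole) (n : ℕ) : (B : CTy) → Stack [] B (.F bool) → Stack [] B (.F bool) → Prop
  | .var _, _, _ => False
  | .nu B, S, S' => ∃ T T', S = T.compS (.unrollS rfl .hole) ∧ S' = T'.compS (.unrollS rfl .hole) ∧
      ∀ m, (_ : m < n) → SRel P m (unfoldNu B) T T'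
  | .F A, S, S' => ∀ m, (_ : m ≤ n) → ∀ V V', VRel P m A V V' →
      P.rel m (S.plug (.ret V)) (S'.plug (.ret V'))
  | .top, _, _ => False
  | .amp B B', S, S' =>
      (∃ T T', S = T.compS (.fstS .hole) ∧ S' = T'.compS (.fstS .hole) ∧ SRel P n B T T') ∨
      ∃ T T', S = T.compS (.sndS .hole) ∧ S' = T'.compS (.sndS .hole) ∧ SRel P n B' T T'
  | .arr A B, S, S' => ∃ T T' V V', S = T.compS (.appS .hole V) ∧ S' = T'.compS (.appS .hole V') ∧
      VRel P n A V V' ∧ SRel P n B T T'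
termination_by B => (n, sizeOf B)
decreasing_by
  all_goals first
    | exact Prod.Lex.left _ _ ‹_›
    | (rcases Nat.lt_or_eq_of_le ‹_ ≤ _› with h | rfl
       · exact Prod.Lex.left _ _ h
       · exact Prod.Lex.right _ (by simp; try omega))
    | exact Prod.Lex.right _ (by simp; try omega)

end

mutual

theorem VRel.mono {P : Pole} {m n : ℕ} (hmn : m ≤ n) :
    (A : VTy) → {V V' : Val [] A} → VRel P n A V V' → VRel P m A V V'
  | .var x, _, _, _ => nomatch x
  | .mu A, V, V', h => by
    rw [VRel] at h ⊢
    obtain ⟨W, W', rfl, rfl, h⟩ := h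
    exact ⟨W, W', rfl, rfl, fun k hk => h k (hk.trans_le hmn)⟩
  | .U B, V, V', h => by
    rw [VRel] at h ⊢
    exact fun k hk => h k (hk.trans hmn)
  | .zero, _, _, h => by rw [VRel] at h; exact h.elim
  | .sum A A', V, V', h => by
    rw [VRel] at h ⊢
    rcases h with ⟨W, W', rfl, rfl, h⟩ | ⟨W, W', rfl, rfl, h⟩
    · exact .inl ⟨W, W', rfl, rfl, VRel.mono hmn A h⟩
    · exact .inr ⟨W, W', rfl, rfl, VRel.mono hmn A' h⟩
  | .one, _, _, h => by rw [VRel] at h ⊢; exact h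
  | .prod A A', V, V', h => by
    rw [VRel] at h ⊢
    obtain ⟨W₁, W₂, W₁', W₂', rfl, rfl, h, h'⟩ := h
    exact ⟨W₁, W₂, W₁', W₂', rfl, rfl, VRel.mono hmn A h, VRel.mono hmn A' h'⟩

theorem SRel.mono {P : Pole} {m n : ℕ} (hmn : m ≤ n) :
    (B : CTy) → {S S' : Stack [] B (.F bool)} → SRel P n B S S' → SRel P m B S S'
  | .var x, _, _, _ => nomatch x
  | .nu B, S, S', h => by
    rw [SRel] at h ⊢
    obtain ⟨T, T', rfl, rfl, h⟩ := h
    exact ⟨T, T', rfl, rfl, fun k hk => h k (hk.trans_le hmn)⟩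
  | .F A, S, S', h => by
    rw [SRel] at h ⊢
    exact fun k hk => h k (hk.trans hmn)
  | .top, _, _, h => by rw [SRel] at h; exact h.elim
  | .amp B B', S, S', h => by
    rw [SRel] at h ⊢
    rcases h with ⟨W, W', rfl, rfl, h⟩ | ⟨W, W', rfl, rfl, h⟩
    · exact .inl ⟨W, W', rfl, rfl, SRel.mono hmn B h⟩
    · exact .inr ⟨W, W', rfl, rfl, SRel.mono hmn B' h⟩
  | .arr A B, S, S', h => by
    rw [SRel] at h ⊢
    obtain ⟨T, T', V, V', rfl, rfl, h, h'⟩ := h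
    exact ⟨T, T', V, V', rfl, rfl, VRel.mono hmn A h, SRel.mono hmn B h'⟩

end

/-- Related closed computations: they do related things under related stacks. -/
def CRel (P : Pole) (n : ℕ) {B : CTy} (M M' : Comp [] B) : Prop :=
  ∀ m ≤ n, ∀ S S', SRel P m B S S' → P.rel m (S.plug M) (S'.plug M')

/-- Related closed stacks whose result type is arbitrary: they extend related stacks on that type
to related stacks. -/
def KRel (P : Pole) (n : ℕ) {B C : CTy} (T T' : Stack [] B C) : Prop :=
  ∀ m ≤ n, ∀ S S', SRel P m C S S' → SRel P m B (S.compS T) (S'.compS T')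

/-- Related closed terms, of any of the three sorts. -/
def JRel (P : Pole) (n : ℕ) : {j : Judg} → Tm [] j → Tm [] j → Prop
  | .val A, V, V' => VRel P n A V V'
  | .comp _, M, M' => CRel P n M M'
  | .stk _ _, T, T' => KRel P n T T'

/-- Related closing substitutions. -/
def EnvRel (P : Pole) (n : ℕ) {Γ : Ctx} (σ σ' : Sub Γ []) : Prop :=
  ∀ A x, VRel P n A (σ A x) (σ' A x)

/-- Related open terms: related closing substitutions make them related at every index. -/
def TmRel (P : Pole) {Γ : Ctx} {j : Judg} (E E' : Tm Γ j) : Prop :=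
  ∀ n σ σ', EnvRel P n σ σ' → JRel P n (E.subst σ) (E'.subst σ')

variable {P : Pole} {m n : ℕ}

theorem EnvRel.mono {Γ : Ctx} {σ σ' : Sub Γ []} (hmn : m ≤ n) (h : EnvRel P n σ σ') :
    EnvRel P m σ σ' := fun A x => VRel.mono hmn A (h A x)

theorem EnvRel.cons {Γ : Ctx} {A : VTy} {V V' : Val [] A} {σ σ' : Sub Γ []}
    (hV : VRel P n A V V') (h : EnvRel P n σ σ') : EnvRel P n (Sub.cons V σ) (Sub.cons V' σ')
  | _, .zero => hV
  | _, .succ x => h _ x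

/-! ### Related closed computations -/

theorem CRel.betaL {B : CTy} {i : ℕ} {M N M' : Comp [] B} (h : Beta i M N) (hN : CRel P n N M') :
    CRel P n M M' := fun m hm S S' hS => P.betaL S h (hN m hm S S' hS)

theorem CRel.betaR {B : CTy} {i : ℕ} {M N M' : Comp [] B} (h : Beta i M N) (hN : CRel P n M' N) :
    CRel P n M' M := fun m hm S S' hS => P.betaR S' h (hN m hm S S' hS)

theorem CRel.beta {B : CTy} {i j : ℕ} {M N M' N' : Comp [] B} (h : Beta i M N) (h' : Beta j M' N')
    (hN : CRel P n N N') : CRel P n M M' := (hN.betaR h').betaL h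

/-- If both sides unroll, what they continue with needs to be related at smaller indices only. -/
theorem CRel.beta_unroll {B : CTy} {M N M' N' : Comp [] B} (h : Beta 1 M N) (h' : Beta 1 M' N')
    (hN : ∀ m < n, CRel P m N N') : CRel P n M M' := by
  intro m hm S S' hS
  cases m with
  | zero => exact P.zero _ _
  | succ m => exact P.unroll S S' h h' (hN m hm m le_rfl S S' (SRel.mono m.le_succ _ hS))

theorem CRel.err {B : CTy} (M' : Comp [] B) : CRel P n .err M' :=
  fun _ _ S _ _ => P.err S _

theorem CRel.ret {A : VTy} {V V' : Val [] A} (h : VRel P n A V V') :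
    CRel P n (.ret V) (.ret V') := by
  intro m hm S S' hS
  rw [SRel] at hS
  exact hS m le_rfl _ _ (VRel.mono hm _ h)

/-- No stack leads from `⊤` to `F 2`, so that computations of type `⊤` are never observed. -/
theorem CRel.top (M M' : Comp [] .top) : CRel P n M M' := by
  intro m hm S S' hS
  rw [SRel] at hS
  exact hS.elim

theorem CRel.arr {A : VTy} {B : CTy} {M M' : Comp [] (.arr A B)}
    (h : ∀ m ≤ n, ∀ V V', VRel P m A V V' → CRel P m (.app M V) (.app M' V')) :
    CRel P n M M' := by
  intro m hm S S' hS
  rw [SRel] at hS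
  obtain ⟨T, T', V, V', rfl, rfl, hV, hT⟩ := hS
  simp only [Tm.compS_plug, Tm.plug]
  exact h m hm V V' hV m le_rfl T T' hT

theorem CRel.amp {B B' : CTy} {M M' : Comp [] (.amp B B')} (h : CRel P n (.fst M) (.fst M'))
    (h' : CRel P n (.snd M) (.snd M')) : CRel P n M M' := by
  intro m hm S S' hS
  rw [SRel] at hS
  rcases hS with ⟨T, T', rfl, rfl, hT⟩ | ⟨T, T', rfl, rfl, hT⟩ <;> simp only [Tm.compS_plug, Tm.plug]
  · exact h m hm T T' hT
  · exact h' m hm T T' hT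

theorem CRel.rollNu {B : Ty [.comp] .comp} {M M' : Comp [] (unfoldNu B)} (h : CRel P n M M') :
    CRel P n (.rollNu M) (.rollNu M') := by
  intro m hm S S' hS
  rw [SRel] at hS
  obtain ⟨T, T', rfl, rfl, hT⟩ := hS
  simp only [Tm.compS_plug, Tm.plug]
  -- `T` and `T'` are related below `m` only, but `roll` meets `unroll`, and this uses up one index.
  cases m with
  | zero => exact P.zero _ _
  | succ m =>
    exact P.unroll T T' (.unroll M) (.unroll M')
      (h m (m.le_succ.trans hm) T T' (hT m m.lt_succ_self))

/-- Expansion by `η` for `ν` leaves the relation unchanged, since it matters only after it has been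
contracted by `β`. -/
theorem CRel.etaNuR {B : Ty [.comp] .comp} {M M' : Comp [] (.nu B)} (h : CRel P n M M') :
    CRel P n M (.rollNu (.unroll rfl M')) := by
  intro m hm S S' hS
  have h := h m hm S S' hS
  rw [SRel] at hS
  obtain ⟨T, T', rfl, rfl, -⟩ := hS
  simp only [Tm.compS_plug T', Tm.plug] at h ⊢
  exact P.betaR T' (.unroll _) h

theorem CRel.etaNuL {B : Ty [.comp] .comp} {M M' : Comp [] (.nu B)} (h : CRel P n M M') :
    CRel P n (.rollNu (.unroll rfl M)) M' := by
  intro m hm S S' hS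
  have h := h m hm S S' hS
  rw [SRel] at hS
  obtain ⟨T, T', rfl, rfl, -⟩ := hS
  simp only [Tm.compS_plug T, Tm.plug] at h ⊢
  exact P.betaL T (.unroll _) h

/-! ### Related closed stacks -/

theorem CRel.plug {B C : CTy} {T T' : Stack [] B C} {M M' : Comp [] B} (hT : KRel P n T T')
    (hM : CRel P n M M') : CRel P n (T.plug M) (T'.plug M') := by
  intro m hm S S' hS
  simpa only [Tm.compS_plug] using hM m hm _ _ (hT m hm S S' hS)

theorem KRel.comp {B C D : CTy} {S S' : Stack [] C D} {T T' : Stack [] B C} (hS : KRel P n S S')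
    (hT : KRel P n T T') : KRel P n (S.compS T) (S'.compS T') := by
  intro m hm K K' hK
  simpa only [Tm.compS_assoc] using hT m hm _ _ (hS m hm K K' hK)

theorem KRel.hole {B : CTy} : KRel P n (.hole : Stack [] B B) .hole := by
  intro m hm S S' hS
  simpa only [Tm.compS_hole] using hS

theorem KRel.app {A : VTy} {B : CTy} {V V' : Val [] A} (h : VRel P n A V V') :
    KRel P n (.appS .hole V : Stack [] (.arr A B) B) (.appS .hole V') := by
  intro m hm S S' hS
  rw [SRel]
  exact ⟨S, S', V, V', rfl, rfl, VRel.mono hm _ h, hS⟩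

theorem KRel.fst {B B' : CTy} : KRel P n (.fstS .hole : Stack [] (.amp B B') B) (.fstS .hole) := by
  intro m hm S S' hS
  rw [SRel]
  exact .inl ⟨S, S', rfl, rfl, hS⟩

theorem KRel.snd {B B' : CTy} : KRel P n (.sndS .hole : Stack [] (.amp B B') B') (.sndS .hole) := by
  intro m hm S S' hS
  rw [SRel]
  exact .inr ⟨S, S', rfl, rfl, hS⟩

theorem KRel.unroll {B : Ty [.comp] .comp} {C : CTy} (h : C = unfoldNu B) :
    KRel P n (.unrollS h .hole : Stack [] (.nu B) C) (.unrollS h .hole) := by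
  subst h
  intro m hm S S' hS
  rw [SRel]
  exact ⟨S, S', rfl, rfl, fun k hk => SRel.mono hk.le _ hS⟩

/-- Stacks on `F A` are related if they are related on returned values. -/
theorem KRel.of_ret {A : VTy} {B : CTy} {T T' : Stack [] (.F A) B}
    (h : ∀ m ≤ n, ∀ V V', VRel P m A V V' → CRel P m (T.plug (.ret V)) (T'.plug (.ret V'))) :
    KRel P n T T' := by
  intro m hm S S' hS
  rw [SRel]
  intro k hk V V' hV
  simpa only [Tm.compS_plug] using
    h k (hk.trans hm) V V' hV k le_rfl S S' (SRel.mono hk _ hS)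

theorem KRel.bind {A : VTy} {B : CTy} {N N' : Comp [A] B}
    (h : ∀ m ≤ n, ∀ V V', VRel P m A V V' → CRel P m (N.inst V) (N'.inst V')) :
    KRel P n (.bindS .hole N) (.bindS .hole N') :=
  .of_ret fun m hm V V' hV => by
    simpa only [Tm.plug] using CRel.beta (.bind V N) (.bind V' N') (h m hm V V' hV)

/-! ### The relation on open terms is a congruence -/

namespace TmRel

variable {Γ : Ctx} {A A' : VTy} {B B' C D : CTy}

/-- Bodies of binders are related once related values are substituted for the bound variable. -/
theorem inst {j : Judg} {E E' : Tm (A :: Γ) j} (h : TmRel P E E') {σ σ' : Sub Γ []}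
    (hσ : EnvRel P n σ σ') {V V' : Val [] A} (hV : VRel P n A V V') :
    JRel P n ((E.subst σ.lift).inst V) ((E'.subst σ'.lift).inst V') := by
  rw [Tm.inst_subst_lift, Tm.inst_subst_lift]
  exact h n _ _ (hσ.cons hV)

theorem rename {Δ : Ctx} {j : Judg} {E E' : Tm Γ j} (h : TmRel P E E') (ρ : Ren Γ Δ) :
    TmRel P (E.rename ρ) (E'.rename ρ) := by
  intro n σ σ' hσ
  rw [Tm.subst_rename, Tm.subst_rename]
  exact h n _ _ fun a x => hσ a _

theorem subst {j : Judg} {E E' : Tm (A :: Γ) j} {V V' : Val Γ A} (h : TmRel P E E')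
    (hV : TmRel P V V') : TmRel P (E.inst V) (E'.inst V') := by
  intro n σ σ' hσ
  rw [Tm.subst_inst, Tm.subst_inst]
  exact h n _ _ (hσ.cons (hV n σ σ' hσ))

theorem var (x : Var Γ A) : TmRel P (.var x) (.var x) := fun _ _ _ hσ => hσ A x

theorem rollMu {A : Ty [.val] .val} {V V' : Val Γ (unfoldMu A)} (h : TmRel P V V') :
    TmRel P (.rollMu V) (.rollMu V') := fun n σ σ' hσ => by
  simp only [JRel, Tm.subst]
  rw [VRel]
  exact ⟨_, _, rfl, rfl, fun m hm => h m σ σ' (hσ.mono hm.le)⟩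

theorem inl {V V' : Val Γ A} (h : TmRel P V V') :
    TmRel P (Tm.inl (A' := A') V) (.inl V') := fun n σ σ' hσ => by
  simp only [JRel, Tm.subst]
  rw [VRel]
  exact .inl ⟨_, _, rfl, rfl, h n σ σ' hσ⟩

theorem inr {V V' : Val Γ A'} (h : TmRel P V V') :
    TmRel P (Tm.inr (A := A) V) (.inr V') := fun n σ σ' hσ => by
  simp only [JRel, Tm.subst]
  rw [VRel]
  exact .inr ⟨_, _, rfl, rfl, h n σ σ' hσ⟩

theorem unit : TmRel P (.unit : Val Γ .one) .unit := fun n σ σ' hσ => by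
  simp only [JRel, Tm.subst]
  rw [VRel]
  exact ⟨rfl, rfl⟩

theorem pair {V V' : Val Γ A} {W W' : Val Γ A'} (hV : TmRel P V V') (hW : TmRel P W W') :
    TmRel P (.pair V W) (.pair V' W') := fun n σ σ' hσ => by
  simp only [JRel, Tm.subst]
  rw [VRel]
  exact ⟨_, _, _, _, rfl, rfl, hV n σ σ' hσ, hW n σ σ' hσ⟩

theorem thunk {M M' : Comp Γ B} (h : TmRel P M M') :
    TmRel P (.thunk M) (.thunk M') := fun n σ σ' hσ => by
  simp only [JRel, Tm.subst]
  rw [VRel]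
  exact CRel.beta (.force _) (.force _) (h n σ σ' hσ)

theorem err (M : Comp Γ B) : TmRel P .err M := fun n σ σ' _ => by
  simp only [Tm.subst]
  exact CRel.err _

theorem letv {V V' : Val Γ A} {M M' : Comp (A :: Γ) B} (hV : TmRel P V V') (hM : TmRel P M M') :
    TmRel P (.letv V M) (.letv V' M') := fun n σ σ' hσ => by
  simp only [Tm.subst]
  exact CRel.beta (.letv _ _) (.letv _ _) (hM.inst hσ (hV n σ σ' hσ))

theorem abort {V V' : Val Γ .zero} (hV : TmRel P V V') :
    TmRel P (Tm.abort (B := B) V) (.abort V') := fun n σ σ' hσ => by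
  have h := hV n σ σ' hσ
  simp only [JRel] at h
  rw [VRel] at h
  exact h.elim

theorem case {V V' : Val Γ (.sum A A')} {M M' : Comp (A :: Γ) B} {N N' : Comp (A' :: Γ) B}
    (hV : TmRel P V V') (hM : TmRel P M M') (hN : TmRel P N N') :
    TmRel P (.case V M N) (.case V' M' N') := fun n σ σ' hσ => by
  have h := hV n σ σ' hσ
  simp only [JRel] at h
  rw [VRel] at h
  simp only [Tm.subst]
  rcases h with ⟨W, W', hW, hW', h⟩ | ⟨W, W', hW, hW', h⟩ <;> rw [hW, hW']
  · exact CRel.beta (.caseInl _ _ _) (.caseInl _ _ _) (hM.inst hσ h)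
  · exact CRel.beta (.caseInr _ _ _) (.caseInr _ _ _) (hN.inst hσ h)

theorem splitUnit {V V' : Val Γ .one} {M M' : Comp Γ B} (hV : TmRel P V V') (hM : TmRel P M M') :
    TmRel P (.splitUnit V M) (.splitUnit V' M') := fun n σ σ' hσ => by
  have h := hV n σ σ' hσ
  simp only [JRel] at h
  rw [VRel] at h
  simp only [Tm.subst]
  rw [h.1, h.2]
  exact CRel.beta (.splitUnit _) (.splitUnit _) (hM n σ σ' hσ)

theorem splitPair {V V' : Val Γ (.prod A A')} {M M' : Comp (A' :: A :: Γ) B}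
    (hV : TmRel P V V') (hM : TmRel P M M') :
    TmRel P (.splitPair V M) (.splitPair V' M') := fun n σ σ' hσ => by
  have h := hV n σ σ' hσ
  simp only [JRel] at h
  rw [VRel] at h
  obtain ⟨W₁, W₂, W₁', W₂', hW, hW', h₁, h₂⟩ := h
  simp only [Tm.subst]
  rw [hW, hW']
  refine CRel.beta (.splitPair _ _ _) (.splitPair _ _ _) ?_
  rw [Tm.inst₂_subst_lift, Tm.inst₂_subst_lift]
  exact hM n _ _ ((hσ.cons h₁).cons h₂)

theorem splitRoll {A : Ty [.val] .val} {V V' : Val Γ (.mu A)} {M M' : Comp (unfoldMu A :: Γ) B}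
    (hV : TmRel P V V') (hM : TmRel P M M') :
    TmRel P (.splitRoll V M) (.splitRoll V' M') := fun n σ σ' hσ => by
  have h := hV n σ σ' hσ
  simp only [JRel] at h
  rw [VRel] at h
  obtain ⟨W, W', hW, hW', h⟩ := h
  simp only [Tm.subst]
  rw [hW, hW']
  exact CRel.beta_unroll (.splitRoll _ _) (.splitRoll _ _)
    fun m hm => hM.inst (hσ.mono hm.le) (h m hm)

theorem force {V V' : Val Γ (.U B)} (h : TmRel P V V') :
    TmRel P (.force V) (.force V') := fun n σ σ' hσ => by
  have h := h n σ σ' hσ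
  simp only [JRel] at h
  rw [VRel] at h
  simp only [Tm.subst]
  exact h

theorem ret {V V' : Val Γ A} (h : TmRel P V V') :
    TmRel P (.ret V) (.ret V') := fun n σ σ' hσ => by
  simp only [Tm.subst]
  exact CRel.ret (h n σ σ' hσ)

theorem lam {M M' : Comp (A :: Γ) B} (h : TmRel P M M') :
    TmRel P (.lam M) (.lam M') := fun n σ σ' hσ => by
  simp only [Tm.subst]
  exact CRel.arr fun m hm V V' hV =>
    CRel.beta (.app _ _) (.app _ _) (h.inst (hσ.mono hm) hV)

theorem triv : TmRel P (.triv : Comp Γ .top) .triv := fun _ _ _ _ => CRel.top _ _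

theorem cpair {M M' : Comp Γ B} {N N' : Comp Γ B'} (hM : TmRel P M M') (hN : TmRel P N N') :
    TmRel P (.cpair M N) (.cpair M' N') := fun n σ σ' hσ => by
  simp only [Tm.subst]
  exact CRel.amp (CRel.beta (.fst _ _) (.fst _ _) (hM n σ σ' hσ))
    (CRel.beta (.snd _ _) (.snd _ _) (hN n σ σ' hσ))

theorem rollNu {B : Ty [.comp] .comp} {M M' : Comp Γ (unfoldNu B)} (h : TmRel P M M') :
    TmRel P (.rollNu M) (.rollNu M') := fun n σ σ' hσ => by
  simp only [Tm.subst]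
  exact CRel.rollNu (h n σ σ' hσ)

theorem hole : TmRel P (.hole : Stack Γ B B) .hole := fun _ _ _ _ => by
  simp only [Tm.subst]
  exact KRel.hole

theorem plug {S S' : Stack Γ B C} {M M' : Comp Γ B} (hS : TmRel P S S') (hM : TmRel P M M') :
    TmRel P (S.plug M) (S'.plug M') := fun n σ σ' hσ => by
  rw [Tm.subst_plug, Tm.subst_plug]
  exact CRel.plug (hS n σ σ' hσ) (hM n σ σ' hσ)

theorem compS {S S' : Stack Γ C D} {T T' : Stack Γ B C} (hS : TmRel P S S')
    (hT : TmRel P T T') : TmRel P (S.compS T) (S'.compS T') := fun n σ σ' hσ => by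
  rw [Tm.subst_compS, Tm.subst_compS]
  exact KRel.comp (hS n σ σ' hσ) (hT n σ σ' hσ)

theorem bindFrame {N N' : Comp (A :: Γ) B} (h : TmRel P N N') :
    TmRel P (.bindS .hole N) (.bindS .hole N') := fun n σ σ' hσ => by
  simp only [Tm.subst]
  exact KRel.bind fun m hm V V' hV => h.inst (hσ.mono hm) hV

theorem appFrame {V V' : Val Γ A} (h : TmRel P V V') :
    TmRel P (.appS .hole V : Stack Γ (.arr A B) B) (.appS .hole V') := fun n σ σ' hσ => by
  simp only [Tm.subst]
  exact KRel.app (h n σ σ' hσ)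

theorem fstFrame : TmRel P (.fstS .hole : Stack Γ (.amp B B') B) (.fstS .hole) :=
  fun _ _ _ _ => by
    simp only [Tm.subst]
    exact KRel.fst

theorem sndFrame : TmRel P (.sndS .hole : Stack Γ (.amp B B') B') (.sndS .hole) :=
  fun _ _ _ _ => by
    simp only [Tm.subst]
    exact KRel.snd

theorem unrollFrame {B : Ty [.comp] .comp} (h : C = unfoldNu B) :
    TmRel P (.unrollS h .hole : Stack Γ (.nu B) C) (.unrollS h .hole) :=
  fun _ _ _ _ => by
    simp only [Tm.subst]
    exact KRel.unroll h

theorem bind {M M' : Comp Γ (.F A)} {N N' : Comp (A :: Γ) B} (hM : TmRel P M M')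
    (hN : TmRel P N N') : TmRel P (.bind M N) (.bind M' N') := by
  simpa only [Tm.plug] using (bindFrame hN).plug hM

theorem app {M M' : Comp Γ (.arr A B)} {V V' : Val Γ A} (hM : TmRel P M M')
    (hV : TmRel P V V') : TmRel P (.app M V) (.app M' V') := by
  simpa only [Tm.plug] using (appFrame hV).plug hM

theorem fst {M M' : Comp Γ (.amp B B')} (h : TmRel P M M') : TmRel P (.fst M) (.fst M') := by
  simpa only [Tm.plug] using fstFrame.plug h

theorem snd {M M' : Comp Γ (.amp B B')} (h : TmRel P M M') : TmRel P (.snd M) (.snd M') := by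
  simpa only [Tm.plug] using sndFrame.plug h

theorem unroll {B : Ty [.comp] .comp} (h : C = unfoldNu B) {M M' : Comp Γ (.nu B)}
    (hM : TmRel P M M') : TmRel P (.unroll h M) (.unroll h M') := by
  simpa only [Tm.plug] using (unrollFrame h).plug hM

theorem bindS {S S' : Stack Γ C (.F A)} {N N' : Comp (A :: Γ) B} (hS : TmRel P S S')
    (hN : TmRel P N N') : TmRel P (.bindS S N) (.bindS S' N') := by
  simpa only [Tm.compS] using (bindFrame hN).compS hS

theorem appS {S S' : Stack Γ C (.arr A B)} {V V' : Val Γ A} (hS : TmRel P S S')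
    (hV : TmRel P V V') : TmRel P (.appS S V) (.appS S' V') := by
  simpa only [Tm.compS] using (appFrame hV).compS hS

theorem fstS {S S' : Stack Γ C (.amp B B')} (h : TmRel P S S') : TmRel P (.fstS S) (.fstS S') := by
  simpa only [Tm.compS] using fstFrame.compS h

theorem sndS {S S' : Stack Γ C (.amp B B')} (h : TmRel P S S') : TmRel P (.sndS S) (.sndS S') := by
  simpa only [Tm.compS] using sndFrame.compS h

theorem unrollS {B : Ty [.comp] .comp} (h : D = unfoldNu B) {S S' : Stack Γ C (.nu B)}
    (hS : TmRel P S S') : TmRel P (.unrollS h S) (.unrollS h S') := by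
  simpa only [Tm.compS] using (unrollFrame h).compS hS

/-- The fundamental property of the logical relation: every term is related to itself. -/
theorem refl {Γ : Ctx} {j : Judg} (E : Tm Γ j) : TmRel P E E := by
  induction E with
  | var x => exact var x
  | rollMu _ h => exact rollMu h
  | inl _ h => exact inl h
  | inr _ h => exact inr h
  | unit => exact unit
  | pair _ _ h h' => exact pair h h'
  | thunk _ h => exact thunk h
  | err => exact err _
  | letv _ _ h h' => exact letv h h'
  | abort _ h => exact abort h
  | case _ _ _ h h₁ h₂ => exact case h h₁ h₂
  | splitUnit _ _ h h' => exact splitUnit h h'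
  | splitPair _ _ h h' => exact splitPair h h'
  | splitRoll _ _ h h' => exact splitRoll h h'
  | force _ h => exact force h
  | ret _ h => exact ret h
  | bind _ _ h h' => exact bind h h'
  | lam _ h => exact lam h
  | app _ _ h h' => exact app h h'
  | triv => exact triv
  | cpair _ _ h h' => exact cpair h h'
  | fst _ h => exact fst h
  | snd _ h => exact snd h
  | rollNu _ h => exact rollNu h
  | unroll e _ h => exact unroll e h
  | hole => exact hole
  | bindS _ _ h h' => exact bindS h h'
  | appS _ _ h h' => exact appS h h'
  | fstS _ h => exact fstS h
  | sndS _ h => exact sndS h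
  | unrollS e _ h => exact unrollS e h

theorem fill {Γ₀ Γ : Ctx} {j₀ j : Judg} (K : Con Γ₀ j₀ Γ j) {E E' : Tm Γ₀ j₀}
    (h : TmRel P E E') : TmRel P (K.fill E) (K.fill E') := by
  induction K with
  | here ρ _ => exact h.rename ρ
  | rollMu _ ih => exact ih.rollMu
  | inl _ ih => exact ih.inl
  | inr _ ih => exact ih.inr
  | pairL _ W ih => exact ih.pair (refl W)
  | pairR V _ ih => exact (refl V).pair ih
  | thunk _ ih => exact ih.thunk
  | letvL _ M ih => exact ih.letv (refl M)
  | letvR V _ ih => exact (refl V).letv ih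
  | abort _ ih => exact ih.abort
  | case₀ _ M N ih => exact ih.case (refl M) (refl N)
  | case₁ V _ N ih => exact (refl V).case ih (refl N)
  | case₂ V M _ ih => exact (refl V).case (refl M) ih
  | splitUnitL _ M ih => exact ih.splitUnit (refl M)
  | splitUnitR V _ ih => exact (refl V).splitUnit ih
  | splitPairL _ M ih => exact ih.splitPair (refl M)
  | splitPairR V _ ih => exact (refl V).splitPair ih
  | splitRollL _ M ih => exact ih.splitRoll (refl M)
  | splitRollR V _ ih => exact (refl V).splitRoll ih
  | force _ ih => exact ih.force
  | ret _ ih => exact ih.ret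
  | bindL _ N ih => exact ih.bind (refl N)
  | bindR M _ ih => exact (refl M).bind ih
  | lam _ ih => exact ih.lam
  | appL _ V ih => exact ih.app (refl V)
  | appR M _ ih => exact (refl M).app ih
  | cpairL _ N ih => exact ih.cpair (refl N)
  | cpairR M _ ih => exact (refl M).cpair ih
  | fst _ ih => exact ih.fst
  | snd _ ih => exact ih.snd
  | rollNu _ ih => exact ih.rollNu
  | unroll e _ ih => exact ih.unroll e
  | run _ M ih => exact ih.plug (refl M)
  | bindSL _ N ih => exact ih.bindS (refl N)
  | bindSR S _ ih => exact (refl S).bindS ih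
  | appSL _ V ih => exact ih.appS (refl V)
  | appSR S _ ih => exact (refl S).appS ih
  | fstS _ ih => exact ih.fstS
  | sndS _ ih => exact ih.sndS
  | unrollS e _ ih => exact ih.unrollS e

end TmRel

/-! ### Axioms of the inequational theory -/

theorem Beta.subst {Γ Δ : Ctx} {B : CTy} {i : ℕ} {M N : Comp Γ B} (h : Beta i M N)
    (σ : Sub Γ Δ) : Beta i (M.subst σ) (N.subst σ) := by
  cases h <;> simp only [Tm.subst, Tm.subst_inst, Tm.subst_inst₂] <;> first
    | constructor
    | (rw [← Tm.inst₂_subst_lift]; constructor)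
    | (rw [← Tm.inst_subst_lift]; constructor)

theorem Sub.exists_cons {Γ Δ : Ctx} {A : VTy} (σ : Sub (A :: Γ) Δ) :
    ∃ V τ, σ = Sub.cons V τ := by
  refine ⟨σ _ .zero, fun a x => σ a (.succ x), ?_⟩
  funext a x
  cases x <;> rfl

theorem Tm.repl_inst {Γ Δ : Ctx} {A A' : VTy} {j : Judg} (E : Tm (A :: Γ) j)
    (W : Val (A' :: A :: Γ) A) (U : Val Δ A) (V : Val Δ A') (τ : Sub Γ Δ) :
    ((E.repl W).subst (Sub.cons U τ).lift).inst V =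
      E.subst (Sub.cons (W.subst (Sub.cons V (Sub.cons U τ))) τ) := by
  rw [Tm.inst_subst_lift, Tm.repl, Tm.subst_subst, Sub.subst_cons]
  rfl

theorem CRel.arr_elim {A : VTy} {B : CTy} {M M' : Comp [] (.arr A B)} (h : CRel P n M M')
    {V V' : Val [] A} (hV : VRel P n A V V') : CRel P n (.app M V) (.app M' V') := by
  simpa only [Tm.plug] using CRel.plug (KRel.app hV) h

namespace TmRel

variable {Γ : Ctx} {A A' : VTy} {B B' C : CTy}

/-- All closing instances of the `β` laws and of the `η` laws of positive types are contractions. -/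
theorem of_beta {M N : Comp Γ B} (h : ∀ σ : Sub Γ [], ∃ i, Beta i (M.subst σ) (N.subst σ)) :
    TmRel P M N ∧ TmRel P N M := by
  constructor <;> intro n σ σ' hσ
  · obtain ⟨i, h⟩ := h σ
    exact CRel.betaL h (refl N n σ σ' hσ)
  · obtain ⟨i, h⟩ := h σ'
    exact CRel.betaR h (refl N n σ σ' hσ)

theorem of_subst_eq {M N : Comp Γ B} (h : ∀ σ : Sub Γ [], M.subst σ = N.subst σ) :
    TmRel P M N ∧ TmRel P N M := by
  constructor <;> intro n σ σ' hσ
  · rw [h]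
    exact refl N n σ σ' hσ
  · rw [h]
    exact refl N n σ σ' hσ

theorem equiAx {j : Judg} {E E' : Tm Γ j} (h : EquiAx E E') :
    TmRel P E E' ∧ TmRel P E' E := by
  cases h with
  | beta h => exact of_beta fun σ => ⟨_, h.subst σ⟩
  | etaZero M =>
    refine (of_beta fun σ => ?_).symm
    obtain ⟨V, τ, rfl⟩ := σ.exists_cons
    cases V with | var x => cases x
  | etaSum M =>
    refine (of_beta fun σ => ?_).symm
    obtain ⟨V, τ, rfl⟩ := σ.exists_cons
    simp only [Tm.subst, Sub.cons]
    cases V with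
    | var x => cases x
    | inl V =>
      refine ⟨0, ?_⟩
      have h := Tm.repl_inst M (.inl (.var .zero)) (.inl V) V τ
      simp only [Tm.subst, Sub.cons] at h
      rw [← h]
      exact .caseInl _ _ _
    | inr V =>
      refine ⟨0, ?_⟩
      have h := Tm.repl_inst M (.inr (.var .zero)) (.inr V) V τ
      simp only [Tm.subst, Sub.cons] at h
      rw [← h]
      exact .caseInr _ _ _
  | etaOne M =>
    refine of_subst_eq fun σ => ?_
    obtain ⟨V, τ, rfl⟩ := σ.exists_cons
    rw [Tm.wk_subst_cons, Tm.subst_inst]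
    cases V with
    | var x => cases x
    | unit => simp only [Tm.subst]
  | etaProd M =>
    refine (of_beta fun σ => ?_).symm
    obtain ⟨V, τ, rfl⟩ := σ.exists_cons
    simp only [Tm.subst, Sub.cons]
    cases V with
    | var x => cases x
    | pair V W =>
      refine ⟨0, ?_⟩
      have h := Beta.splitPair V W ((M.subst (Sub.cons (.pair (.var (.succ .zero)) (.var .zero))
        (fun _ x => .var (.succ (.succ (.succ x)))))).subst (Sub.cons (.pair V W) τ).lift.lift)
      rw [Tm.inst₂_subst_lift] at h
      nth_rw 2 [Tm.subst_subst] at h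
      rw [Sub.subst_cons] at h
      simp only [Tm.subst, Sub.cons] at h
      exact h
  | etaMu M =>
    refine (of_beta fun σ => ?_).symm
    obtain ⟨V, τ, rfl⟩ := σ.exists_cons
    simp only [Tm.subst, Sub.cons]
    cases V with
    | var x => cases x
    | rollMu V =>
      refine ⟨1, ?_⟩
      have h := Tm.repl_inst M (.rollMu (.var .zero)) (.rollMu V) V τ
      simp only [Tm.subst, Sub.cons] at h
      rw [← h]
      exact .splitRoll _ _
  | etaU V =>
    constructor <;> intro n σ σ' hσ <;> have h := (refl V).force n σ σ' hσ <;>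
      simp only [JRel, Tm.subst] at h ⊢ <;> rw [VRel]
    · exact h.betaR (.force _)
    · exact h.betaL (.force _)
  | etaF S =>
    have key : ∀ (σ : Sub Γ []) V, Beta 0
        (((Tm.bindS .hole (S.wk.plug (.ret (.var .zero)))).subst σ).plug (.ret V))
        ((S.subst σ).plug (.ret V)) := fun σ V => by
      have h := Beta.bind V ((S.wk.plug (.ret (.var .zero))).subst σ.lift)
      rw [Tm.inst_subst_lift, Tm.subst_plug _ _ (.ret _), Tm.subst_plug (.cons V σ),
        Tm.wk_subst_cons] at h
      simpa only [Tm.subst_plug, Tm.subst, Tm.plug, Sub.cons] using h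
    constructor <;> intro n σ σ' hσ <;> refine KRel.of_ret fun m hm V V' hV => ?_ <;>
      have h := CRel.plug (refl S m σ σ' (hσ.mono hm)) (CRel.ret hV)
    · exact h.betaR (key σ' V')
    · exact h.betaL (key σ V)
  | @etaArr _ A B M =>
    have key : ∀ (σ : Sub Γ []) (V : Val [] A), Beta 0
        (.app ((Tm.lam (.app M.wk (.var .zero))).subst σ) V) (.app (M.subst σ) V) :=
      fun σ V => by
        have h := Beta.app ((Tm.app M.wk (.var .zero)).subst σ.lift) V
        rw [Tm.inst_subst_lift] at h
        simpa only [Tm.subst, Tm.wk_subst_cons, Sub.cons] using h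
    constructor <;> intro n σ σ' hσ <;> refine CRel.arr fun m hm V V' hV => ?_ <;>
      have h := CRel.arr_elim (refl M m σ σ' (hσ.mono hm)) hV
    · exact h.betaR (key σ' V')
    · exact h.betaL (key σ V)
  | etaAmp M =>
    constructor <;> intro n σ σ' hσ <;>
      have h := (refl M).fst n σ σ' hσ <;> have h' := (refl M).snd n σ σ' hσ <;>
      simp only [Tm.subst] at h h' ⊢
    · exact CRel.amp (CRel.betaR (.fst _ _) h) (CRel.betaR (.snd _ _) h')
    · exact CRel.amp (CRel.betaL (.fst _ _) h) (CRel.betaL (.snd _ _) h')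
  | etaTop M => exact ⟨fun _ _ _ _ => CRel.top _ _, fun _ _ _ _ => CRel.top _ _⟩
  | etaNu M =>
    constructor <;> intro n σ σ' hσ <;> have h := refl M n σ σ' hσ <;> simp only [Tm.subst]
    · exact CRel.etaNuR h
    · exact CRel.etaNuL h
  | strict S =>
    -- An error discards any stack, in particular one that is composed with `S`.
    refine ⟨fun n σ σ' _ => ?_, err _⟩
    rw [Tm.subst_plug]
    simp only [Tm.subst]
    intro m _ K K' _
    rw [← Tm.compS_plug]
    exact P.err _ _

end TmRel

/-! ### Derivable inequalities -/

theorem transGen_lift₂ {α β γ : Type} {r : α → α → Prop} {s : β → β → Prop} {t : γ → γ → Prop}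
    (f : α → β → γ) (hr : ∀ a, r a a) (hs : ∀ b, s b b)
    (hf : ∀ {a a' b b'}, r a a' → s b b' → t (f a b) (f a' b')) {a a' : α} {b b' : β}
    (ha : Relation.TransGen r a a') (hb : Relation.TransGen s b b') :
    Relation.TransGen t (f a b) (f a' b') :=
  (ha.lift (f · b) fun _ _ h => hf h (hs b)).trans (hb.lift (f a' ·) fun _ _ h => hf (hr a') h)

open Relation TmRel in
/-- The logical relation at a fixed pole need not be transitive, but its transitive closure inherits
all of its closure properties because it is reflexive. -/
theorem Ineq.transGen (P : Pole) {Γ : Ctx} {j : Judg} {E E' : Tm Γ j} (h : Ineq E E') :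
    TransGen (TmRel P) E E' := by
  induction h with
  | refl E => exact .single (.refl E)
  | trans _ _ h h' => exact h.trans h'
  | ax h => exact .single (equiAx h).1
  | axOp h => exact .single (equiAx h).2
  | errBot M => exact .single (err M)
  | subst _ _ h h' => exact transGen_lift₂ Tm.inst .refl .refl .subst h h'
  | plug _ _ h h' => exact transGen_lift₂ Tm.plug .refl .refl .plug h h'
  | compS _ _ h h' => exact transGen_lift₂ Tm.compS .refl .refl .compS h h'
  | rollMu _ h => exact h.lift _ fun _ _ => .rollMu
  | inl _ h => exact h.lift _ fun _ _ => .inl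
  | inr _ h => exact h.lift _ fun _ _ => .inr
  | pair _ _ h h' => exact transGen_lift₂ Tm.pair .refl .refl .pair h h'
  | thunk _ h => exact h.lift _ fun _ _ => .thunk
  | letv _ _ h h' => exact transGen_lift₂ Tm.letv .refl .refl .letv h h'
  | abort _ h => exact h.lift _ fun _ _ => .abort
  | @case _ _ _ _ V V' M M' N N' _ _ _ h h₁ h₂ =>
    exact (h.lift (Tm.case · M N) fun _ _ h => h.case (.refl M) (.refl N)).trans
      (transGen_lift₂ (Tm.case V') .refl .refl (TmRel.case (.refl V')) h₁ h₂)
  | splitUnit _ _ h h' => exact transGen_lift₂ Tm.splitUnit .refl .refl .splitUnit h h'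
  | splitPair _ _ h h' => exact transGen_lift₂ Tm.splitPair .refl .refl .splitPair h h'
  | splitRoll _ _ h h' => exact transGen_lift₂ Tm.splitRoll .refl .refl .splitRoll h h'
  | force _ h => exact h.lift _ fun _ _ => .force
  | ret _ h => exact h.lift _ fun _ _ => .ret
  | bind _ _ h h' => exact transGen_lift₂ Tm.bind .refl .refl .bind h h'
  | lam _ h => exact h.lift _ fun _ _ => .lam
  | app _ _ h h' => exact transGen_lift₂ Tm.app .refl .refl .app h h'
  | cpair _ _ h h' => exact transGen_lift₂ Tm.cpair .refl .refl .cpair h h'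
  | fst _ h => exact h.lift _ fun _ _ => .fst
  | snd _ h => exact h.lift _ fun _ _ => .snd
  | rollNu _ h => exact h.lift _ fun _ _ => .rollNu
  | unroll e _ h => exact h.lift _ fun _ _ => .unroll e
  | bindS _ _ h h' => exact transGen_lift₂ Tm.bindS .refl .refl .bindS h h'
  | appS _ _ h h' => exact transGen_lift₂ Tm.appS .refl .refl .appS h h'
  | fstS _ h => exact h.lift _ fun _ _ => .fstS
  | sndS _ h => exact h.lift _ fun _ _ => .sndS
  | unrollS e _ h => exact h.lift _ fun _ _ => .unrollS e

/-! ### Adequacy -/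

/-- The empty stack is related to itself, because related booleans are equal. -/
theorem SRel.hole_bool (P : Pole) (n : ℕ) : SRel P n (.F bool) .hole .hole := by
  rw [SRel]
  intro m _ V V' hV
  rw [VRel] at hV
  simp only [Tm.plug]
  rcases hV with ⟨W, W', rfl, rfl, h⟩ | ⟨W, W', rfl, rfl, h⟩ <;> rw [VRel] at h <;>
    obtain ⟨rfl, rfl⟩ := h
  · exact P.tt m
  · exact P.ff m

theorem TmRel.rel {P : Pole} {M M' : Program} (h : TmRel P M M') (n : ℕ) : P.rel n M M' := by
  have h := h n (fun _ x => .var x) (fun _ x => .var x) (fun _ x => nomatch x) n le_rfl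
    .hole .hole (SRel.hole_bool P n)
  simpa only [Tm.plug, Tm.subst_id] using h

/-- By determinism, a terminating run starts with any given first step. -/
theorem Steps.inv {i k : ℕ} {M N R : Program} (s : Step i M N) (h : Steps k M R) (hR : Final R) :
    ∃ l, k = i + l ∧ Steps l N R := by
  cases h with
  | refl => exact (hR _ _ s).elim
  | step s' t =>
    obtain ⟨rfl, rfl⟩ := s.deterministic s'
    exact ⟨_, rfl, t⟩

theorem Steps.plug_err {B : CTy} (S : Stack [] B (.F bool)) : ∃ i, Steps i (S.plug .err) .err := by
  by_cases h : S.plug .err = .err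
  · rw [h]
    exact ⟨0, .refl _⟩
  · exact ⟨_, .step (.error S h) (.refl _)⟩

/-- The observation that whatever the left program returns within the given number of unrollings is
also returned by the right one. -/
def Pole.left : Pole where
  rel n M M' := ∀ i < n, ∀ V : Val [] bool, Steps i M (.ret V) → ∃ j, Steps j M' (.ret V)
  zero _ _ _ h := absurd h (Nat.not_lt_zero _)
  mono hmn h i hi := h i (hi.trans_le hmn)
  betaL S _ b h k hk V s := by
    obtain ⟨l, rfl, t⟩ := Steps.inv (.beta S b) s (.ret V)
    exact h l (by omega) V t
  betaR S _ b h k hk V s := by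
    obtain ⟨j, t⟩ := h k hk V s
    exact ⟨_, .step (.beta S b) t⟩
  unroll S S' b b' h k hk V s := by
    obtain ⟨l, rfl, t⟩ := Steps.inv (.beta S b) s (.ret V)
    obtain ⟨j, t⟩ := h l (by omega) V t
    exact ⟨_, .step (.beta S' b') t⟩
  err S _ k _ V s := by
    obtain ⟨i, t⟩ := Steps.plug_err S
    cases s.final_unique t (.ret V) .err
  tt _ _ _ _ s := ⟨_, s⟩
  ff _ _ _ _ s := ⟨_, s⟩

/-- The observation that whatever the right program ends with within the given number of unrollings
is also what the left one ends with, unless that ends with an error. -/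
def Pole.right : Pole where
  rel n M M' := ∀ i < n, ∀ R, Final R → Steps i M' R → ∃ j, Steps j M R ∨ Steps j M .err
  zero _ _ _ h := absurd h (Nat.not_lt_zero _)
  mono hmn h i hi := h i (hi.trans_le hmn)
  betaL S _ b h k hk R hR s := by
    obtain ⟨j, t⟩ := h k hk R hR s
    exact ⟨_, t.imp (.step (.beta S b)) (.step (.beta S b))⟩
  betaR S _ b h k hk R hR s := by
    obtain ⟨l, rfl, t⟩ := Steps.inv (.beta S b) s hR
    exact h l (by omega) R hR t
  unroll S S' b b' h k hk R hR s := by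
    obtain ⟨l, rfl, t⟩ := Steps.inv (.beta S' b') s hR
    obtain ⟨j, t⟩ := h l (by omega) R hR t
    exact ⟨_, t.imp (.step (.beta S b)) (.step (.beta S b))⟩
  err S _ k _ R _ _ := by
    obtain ⟨i, t⟩ := Steps.plug_err S
    exact ⟨i, .inr t⟩
  tt _ _ _ _ _ s := ⟨_, .inl s⟩
  ff _ _ _ _ _ s := ⟨_, .inl s⟩

theorem ErrLe.antisymm {R R' : Result} (h : ErrLe R R') (h' : ErrLe R' R) : R = R' := by
  cases h <;> cases h' <;> rfl

open Relation in
theorem Pole.left_of_transGen {M M' : Program} (h : TransGen (TmRel Pole.left) M M')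
    {i : ℕ} {V : Val [] bool} (s : Steps i M (.ret V)) : ∃ j, Steps j M' (.ret V) := by
  induction h with
  | single h => exact h.rel (i + 1) i i.lt_succ_self V s
  | tail _ h ih =>
    obtain ⟨j, t⟩ := ih
    exact h.rel (j + 1) j j.lt_succ_self V t

open Relation in
theorem Pole.right_of_transGen {M M' : Program} (h : TransGen (TmRel Pole.right) M M')
    {i : ℕ} {R : Program} (hR : Final R) (s : Steps i M' R) :
    ∃ j, Steps j M R ∨ Steps j M .err := by
  induction h generalizing i R with
  | single h => exact h.rel (i + 1) i i.lt_succ_self R hR s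
  | tail _ h ih =>
    obtain ⟨j, t | t⟩ := h.rel (i + 1) i i.lt_succ_self R hR s
    · exact ih hR t
    · obtain ⟨k, u⟩ := ih .err t
      exact ⟨k, .inr (u.elim id id)⟩

open Relation in
/-- Error approximation splits into the two observations: the right one settles the case in which
the right program terminates, and the left one excludes that only the left program returns. -/
theorem ErrLe.of_transGen {M M' : Program} (hl : TransGen (TmRel Pole.left) M M')
    (hr : TransGen (TmRel Pole.right) M M') : ErrLe (result M) (result M') := by
  have final : ∀ {R : Program} {Q : Result} {i : ℕ}, Final R → Steps i M' R →
      (∀ j, Steps j M R → HasResult M Q) → ErrLe (result M) Q := by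
    intro R Q i hR s hQ
    obtain ⟨j, t | t⟩ := Pole.right_of_transGen hr hR s
    · rw [hasResult_iff.1 (hQ j t)]
      exact .refl _
    · rw [hasResult_iff.1 (show HasResult M .error from ⟨j, t⟩)]
      exact .error _
  have h := hasResult_iff.2 (rfl : result M = _)
  have h' := hasResult_iff.2 (rfl : result M' = _)
  cases hQ' : result M' with
  | error =>
    rw [hQ'] at h'
    obtain ⟨i, s⟩ := h'
    exact final .err s fun j t => ⟨j, t⟩
  | tt =>
    rw [hQ'] at h'
    obtain ⟨i, s⟩ := h'
    exact final (.ret _) s fun j t => ⟨j, t⟩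
  | ff =>
    rw [hQ'] at h'
    obtain ⟨i, s⟩ := h'
    exact final (.ret _) s fun j t => ⟨j, t⟩
  | diverge =>
    rw [hQ'] at h'
    cases hQ : result M with
    | diverge => exact .refl _
    | error => exact .error _
    | tt =>
      rw [hQ] at h
      obtain ⟨i, s⟩ := h
      cases h'.unique (R' := .tt) (Pole.left_of_transGen hl s)
    | ff =>
      rw [hQ] at h
      obtain ⟨i, s⟩ := h
      cases h'.unique (R' := .ff) (Pole.left_of_transGen hl s)

theorem Ineq.ctxLift {Γ : Ctx} {j : Judg} {E E' : Tm Γ j} (h : Ineq E E') :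
    CtxLift ErrLe E E' := fun C =>
  .of_transGen ((h.transGen .left).lift C.fill fun _ _ => .fill C)
    ((h.transGen .right).lift C.fill fun _ _ => .fill C)

end CBPV

theorem mainTheorem6 :
    (∀ (Γ : CBPV.Ctx) (j : CBPV.Judg) (E E' : CBPV.Tm Γ j),
      CBPV.Ineq E E' → CBPV.CtxLift CBPV.ErrLe E E') ∧
    (∀ (Γ : CBPV.Ctx) (j : CBPV.Judg) (E E' : CBPV.Tm Γ j),
      CBPV.EquiIneq E E' → CBPV.CtxLift Eq E E') :=
  ⟨fun _ _ _ _ h => h.ctxLift, fun _ _ _ _ h C => (h.1.ctxLift C).antisymm (h.2.ctxLift C)⟩
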